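/- **Conventions.** For $A\in M_d(\mathbb C)$, $d\ge 1$, let $\|A\|_f=(\operatorname{tr}(A^*A)/d)^{1/2}$ (little Frobenius norm) and let $\overline A$ be the entrywise complex conjugate. For a finite set $S$ and a finite set $R$ of complex noncommutative $*$-polynomials in $S$, an *$\epsilon$-representation* of $\mathbb C^*\langle S:R\rangle$ on $\mathbb C^d$ is a map $\phi:S\to M_d(\mathbb C)$, extended to a unital $*$-homomorphism on the free $*$-algebra $\mathbb{C}^*\langle S\rangle$, with $\|\phi(r)\|_f\le\epsilon$ for all $r\in R$. Let $|\psi_d\rangle=d^{-1/2}\sum_{t=1}^d|t\rangle\otimes|t\rangle\in\mathbb C^d\otimes\mathbb C^d$, a maximally entangled state. A (projective) strategy for a nonlocal game with question distribution $\eta$ and predicate $V\in\{0,1\}$ consists of orthogonal projections $P^i_a$, $Q^j_b$ on finite-dimensional spaces $H_A$, $H_B$ with $\sum_aP^i_a=\mathbb 1$, $\sum_bQ^j_b=\mathbb 1$, and a unit vector $|\psi\rangle\in H_A\otimes H_B$; it is *$\delta$-perfect* if $\sum_{i,j}\eta(i,j)\sum_{a,b}V(a,b|i,j)\langle\psi|P^i_a\otimes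 Q^j_b|\psi\rangle\ge 1-\delta$. **Theorem.** 1. *(Synchronous games.)* Let $\mathcal G$ be a synchronous game with finite question set $I$ and finite non-empty answer set $A$ for both players, so that $V(a,b|i,i)=0$ for $a\ne b$. Let $\mathcal A(\mathcal G)$ have generators $p^i_a$ and relations $(p^i_a)^2=p^i_a=(p^i_a)^*$, $\sum_ap^i_a=1$, and $p^i_ap^j_b=0$ whenever $V(a,b|i,j)=0$. There is a constant $C$ depending only on $\mathcal G$ such that for all $d\ge1$, $\epsilon\ge0$ and every $\epsilon$-representation $\phi$ of $\mathcal A(\mathcal G)$ on $\mathbb C^d$ there is a $C\epsilon^2$-perfect strategy for $\mathcal G$ on $\mathbb C^d\otimes\mathbb C^d$ with state $|\psi_d\rangle$, $P^i_a=\overline{Q^i_a}$, $\|Q^i_a-\phi(p^i_a)\|_f\le C\epsilon$ and $\|P^i_a-\overline{\phi(p^i_a)}\|_f\le C\epsilon$ for all $i,a$. 2. *(BCS games.)* Let a binary constraint system have variables $x_1,\dots,x_n$ and constraints $C_1,\dots,C_m$, where $C_i$ is given by a scope $K_i=(x_{\ell_1},\dots,x_{\ell_k})$ of distinct variables and a function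 $g_i:\{0,1\}^k\to\{0,1\}$ ($1$ meaning satisfied). In the game $\mathcal G$, with an arbitrary distribution on pairs $(i,j)$, Alice gets $i$ and answers with $\alpha\in\{0,1\}^{K_i}$, Bob gets $j$ and answers with $b\in\{0,1\}$ (a bit $b$ stands for the value $(-1)^b$); they win iff $g_i(\alpha)=1$ and either $x_j\notin K_i$ or $\alpha_j=b$. Let $f_i=\sum_{\alpha}(-1)^{g_i(\alpha)}\prod_{r=1}^k\frac{1+(-1)^{\alpha_r}x_{\ell_r}}2$ (factors in the order of the scope), and let $\mathcal B(\mathcal G)$ have generators $x_1,\dots,x_n$ and relations $x_j^*=x_j$, $x_j^2=1$, $f_i=-1$, and $x_jx_{j'}=x_{j'}x_j$ for $x_j,x_{j'}\in K_i$. There is a constant $C$ depending only on $\mathcal G$ such that for all $d\ge1$, $\epsilon\ge0$ and every $\epsilon$-representation $\phi$ of $\mathcal B(\mathcal G)$ on $\mathbb C^d$ there is a $C\epsilon^2$-perfect strategy for $\mathcal G$ on $\mathbb C^d\otimes\mathbb C^d$ with state $|\psi_d\rangle$ whose observables $X_j=\sum_b(-1)^bQ^j_b$ and $Z_{ij}=\sum_\alpha(-1)^{\alpha_j}P^i_\alpha$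 satisfy $\|X_j-\phi(x_j)\|_f\le C\epsilon$ for all $j$ and $\|Z_{ij}-\overline{\phi(x_j)}\|_f\le C\epsilon$ for all $i$ and $x_j\in K_i$. 3. *(XOR games.)* Let $\mathcal G$ be an $m\times n$ XOR game with bits $t_{ij}$, question distribution $\pi$ and cost matrix $g_{ij}=(-1)^{t_{ij}}\pi(i,j)$. A strategy consists of self-adjoint unitaries $Y_1,\dots,Y_m$ on $H_A$ and $X_1,\dots,X_n$ on $H_B$ ($H_A,H_B$ finite-dimensional) and a unit vector $|\psi\rangle\in H_A\otimes H_B$; its bias is $\beta=\sum_{ij}g_{ij}\langle\psi|Y_i\otimes X_j|\psi\rangle$, $\beta^*$ is the supremum of the biases of all strategies, and a strategy is *optimal* if $\beta=\beta^*$ and *$\delta$-optimal* if $|\beta-\beta^*|\le\delta$. There are unique reals $c_1,\dots,c_m$ (the marginal row biases) such that $\sum_jg_{ij}(\mathbb 1\otimes X_j)|\psi\rangle=c_i(Y_i\otimes\mathbb 1)|\psi\rangle$ for all $i$ in every optimal strategy. Let $\mathcal C(\mathcal G)$ have generators $s_1,\dots,s_n$ and relations $s_j^*=s_j$, $s_j^2=1$,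 $\bigl(\sum_jg_{ij}s_j\bigr)^2=c_i^2$. There is a constant $C$ depending only on $\mathcal G$ such that for all $d\ge1$, $\epsilon\ge0$ and every $\epsilon$-representation $\phi$ of $\mathcal C(\mathcal G)$ on $\mathbb C^d$ there is a $C\epsilon$-optimal strategy on $\mathbb C^d\otimes\mathbb C^d$ with state $|\psi_d\rangle$ such that $\|X_j-\phi(s_j)\|_f\le C\epsilon$ for all $j$ and $\bigl\|Y_i-\overline{c_i^{-1}\sum_jg_{ij}\phi(s_j)}\bigr\|_f\le C\epsilon$ for all $i$ with $c_i\ne0$. -/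

import Mathlib

open scoped Matrix Kronecker

noncomputable section

namespace GameAlg

/-! ### Finitely presented `*`-algebras and approximate representations -/

/-- The free complex unital `*`-algebra on `S`, as the free algebra on the symbols `s` and `s*`. -/
abbrev FreeStar (S : Type*) : Type _ := FreeAlgebra ℂ (S ⊕ S)

/-- The generator `s`. -/
def gen {S : Type*} (s : S) : FreeStar S := FreeAlgebra.ι ℂ (Sum.inl s)

/-- The adjoint `s*` of the generator `s`. -/
def genStar {S : Type*} (s : S) : FreeStar S := FreeAlgebra.ι ℂ (Sum.inr s)

/-- A finite presentation `⟨S : R⟩` of a complex `*`-algebra; `r ∈ rel` stands for `r = 0`. -/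
structure StarPresentation (S : Type*) where
  rel : Set (FreeStar S)
  finite_rel : rel.Finite

/-- The value of a `*`-polynomial at the matrices `φ s`: the unital `*`-homomorphism
from the free `*`-algebra to `M_d(ℂ)` that extends `φ`. -/
def evalStar {S : Type*} {d : ℕ} (φ : S → Matrix (Fin d) (Fin d) ℂ) :
    FreeStar S →ₐ[ℂ] Matrix (Fin d) (Fin d) ℂ :=
  FreeAlgebra.lift ℂ (Sum.elim φ (fun s => (φ s)ᴴ))

/-- The little Frobenius norm `‖A‖_f = (tr (A* A) / d)^{1/2}`. -/
def littleFrob {d : ℕ} (A : Matrix (Fin d) (Fin d) ℂ) : ℝ :=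
  Real.sqrt ((Aᴴ * A).trace.re / d)

/-- `φ` is an `ε`-representation on `ℂ^d` with respect to the little Frobenius norm. -/
def StarPresentation.IsApproxRep {S : Type*} (𝒜 : StarPresentation S) {d : ℕ} (ε : ℝ)
    (φ : S → Matrix (Fin d) (Fin d) ℂ) : Prop :=
  ∀ r ∈ 𝒜.rel, littleFrob (evalStar φ r) ≤ ε

/-! ### Bipartite states -/

/-- `⟨ψ| P ⊗ Q |ψ⟩`, which is real for Hermitian `P` and `Q`. -/
def expect {dA dB : ℕ} (ψ : Fin dA × Fin dB → ℂ)
    (P : Matrix (Fin dA) (Fin dA) ℂ) (Q : Matrix (Fin dB) (Fin dB) ℂ) : ℝ :=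
  (star ψ ⬝ᵥ ((P ⊗ₖ Q) *ᵥ ψ)).re

/-- The reduced density matrix on the first factor. -/
def reducedA {dA dB : ℕ} (ψ : Fin dA × Fin dB → ℂ) : Matrix (Fin dA) (Fin dA) ℂ :=
  fun s s' => ∑ t, ψ (s, t) * star (ψ (s', t))

/-- The reduced density matrix on the second factor. -/
def reducedB {dA dB : ℕ} (ψ : Fin dA × Fin dB → ℂ) : Matrix (Fin dB) (Fin dB) ℂ :=
  fun t t' => ∑ s, ψ (s, t) * star (ψ (s, t'))

/-- A unit vector of `ℂ^d ⊗ ℂ^d` is maximally entangled if its reduced density matrices are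
`1 / d`. -/
def IsMaximallyEntangled {d : ℕ} (ψ : Fin d × Fin d → ℂ) : Prop :=
  star ψ ⬝ᵥ ψ = 1 ∧
    reducedA ψ = (d : ℂ)⁻¹ • (1 : Matrix (Fin d) (Fin d) ℂ) ∧
    reducedB ψ = (d : ℂ)⁻¹ • (1 : Matrix (Fin d) (Fin d) ℂ)

/-- The maximally entangled state `d^{-1/2} ∑ₜ |t⟩ ⊗ |t⟩`. -/
def maxEntangled (d : ℕ) : Fin d × Fin d → ℂ :=
  fun p => if p.1 = p.2 then ((Real.sqrt d : ℝ) : ℂ)⁻¹ else 0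

/-! ### Nonlocal games and projective strategies -/

/-- A two-player nonlocal game; the answer sets may depend on the question. -/
structure NonlocalGame (I J : Type*) [Fintype I] [Fintype J] (A : I → Type*) (B : J → Type*) where
  η : I → J → ℝ
  η_nonneg : ∀ i j, 0 ≤ η i j
  η_sum : ∑ i, ∑ j, η i j = 1
  V : ∀ i j, A i → B j → Bool

/-- A projective quantum strategy on `ℂ^dA ⊗ ℂ^dB`. -/
structure QStrategy {I J : Type*} (A : I → Type*) (B : J → Type*)
    [∀ i, Fintype (A i)] [∀ j, Fintype (B j)] (dA dB : ℕ) where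
  P : ∀ i, A i → Matrix (Fin dA) (Fin dA) ℂ
  Q : ∀ j, B j → Matrix (Fin dB) (Fin dB) ℂ
  P_herm : ∀ i a, (P i a)ᴴ = P i a
  P_idem : ∀ i a, P i a * P i a = P i a
  P_sum : ∀ i, ∑ a, P i a = 1
  Q_herm : ∀ j b, (Q j b)ᴴ = Q j b
  Q_idem : ∀ j b, Q j b * Q j b = Q j b
  Q_sum : ∀ j, ∑ b, Q j b = 1
  ψ : Fin dA × Fin dB → ℂ
  ψ_unit : star ψ ⬝ᵥ ψ = 1

section Value

variable {I J : Type*} [Fintype I] [Fintype J] {A : I → Type*} {B : J → Type*}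
  [∀ i, Fintype (A i)] [∀ j, Fintype (B j)] {dA dB : ℕ}

/-- The winning probability `ω(𝒢; 𝒮)`. -/
def NonlocalGame.winProb (G : NonlocalGame I J A B) (S : QStrategy A B dA dB) : ℝ :=
  ∑ i, ∑ j, G.η i j * ∑ a, ∑ b, if G.V i j a b then expect S.ψ (S.P i a) (S.Q j b) else 0

/-- `δ`-perfect strategies. -/
def NonlocalGame.IsPerfectUpTo (G : NonlocalGame I J A B) (δ : ℝ) (S : QStrategy A B dA dB) :
    Prop :=
  1 - δ ≤ G.winProb S

end Value

/-- The sign `(-1)^b` of a bit. -/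
def sgn (b : Bool) : ℂ := if b then -1 else 1

/-! ### Synchronous games -/

/-- A synchronous game: different answers to the same question lose. -/
structure SynchronousGame (I A : Type*) [Fintype I] extends
    NonlocalGame I I (fun _ => A) (fun _ => A) where
  sync : ∀ i a b, a ≠ b → V i i a b = false

/-- The synchronous game algebra, with generators `p_a^i`. -/
def SynchronousGame.algebra {I A : Type*} [Fintype I] [Fintype A] (G : SynchronousGame I A) :
    StarPresentation (I × A) where
  rel :=
    Set.range (fun s : I × A => gen s * gen s - gen s) ∪
    Set.range (fun s : I × A => genStar s - gen s) ∪
    Set.range (fun i : I => (∑ a : A, gen (i, a)) - 1) ∪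
    (fun q : (I × A) × (I × A) => gen q.1 * gen q.2) ''
      {q | G.V q.1.1 q.2.1 q.1.2 q.2.2 = false}
  finite_rel := Set.toFinite _

/-- A synchronous strategy: Alice's projections are the entrywise conjugates of Bob's. -/
def IsSynchronous {I A : Type*} [Fintype A] {d : ℕ}
    (S : QStrategy (fun _ : I => A) (fun _ : I => A) d d) : Prop :=
  ∀ i a, S.P i a = (S.Q i a).map star

/-! ### Binary constraint system games -/

/-- A binary constraint system in the variables `x_1, …, x_n` with constraints `C_1, …, C_m`, and a
distribution of questions. The scope of `C_i` is a tuple of distinct variables; the bit `b` stands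
for the value `(-1)^b`, and `C_i` is satisfied by the bits `α` when `constraint i α` is `true`. -/
structure BCSGame (m n : ℕ) where
  arity : Fin m → ℕ
  scope : ∀ i, Fin (arity i) ↪ Fin n
  constraint : ∀ i, (Fin (arity i) → Bool) → Bool
  η : Fin m → Fin n → ℝ
  η_nonneg : ∀ i j, 0 ≤ η i j
  η_sum : ∑ i, ∑ j, η i j = 1

namespace BCSGame

variable {m n : ℕ} (G : BCSGame m n)

/-- Alice's answers to constraint `i`: assignments to its scope. -/
abbrev Assign (i : Fin m) : Type := Fin (G.arity i) → Bool

/-- Alice gets a constraint and must answer with a satisfying assignment to its scope; Bob gets a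
variable and answers with a value; if the variable is in the scope, the values must agree. -/
def toNonlocalGame : NonlocalGame (Fin m) (Fin n) G.Assign (fun _ => Bool) where
  η := G.η
  η_nonneg := G.η_nonneg
  η_sum := G.η_sum
  V := fun i j α b => G.constraint i α && decide (∀ l, G.scope i l = j → α l = b)

/-- The `±1`-valued multilinear polynomial
`f_i = ∑_α (-1)^{C_i(α)} ∏_l (1 + (-1)^{α_l} x_l) / 2` of constraint `i`. The factors are taken in
the order of the scope, so that this is `∑_S f̂_S ∏_{l ∈ S} x_l` with ordered monomials. -/
def poly (i : Fin m) : FreeStar (Fin n) :=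
  ∑ α : G.Assign i, sgn (G.constraint i α) •
    (List.ofFn fun l => (2⁻¹ : ℂ) • (1 + sgn (α l) • gen (G.scope i l))).prod

/-- The BCS game algebra, with generators `x_1, …, x_n`. -/
def algebra : StarPresentation (Fin n) where
  rel :=
    Set.range (fun j : Fin n => genStar j - gen j) ∪
    Set.range (fun j : Fin n => gen j * gen j - 1) ∪
    Set.range (fun i : Fin m => G.poly i + 1) ∪
    Set.range (fun q : Σ i : Fin m, Fin (G.arity i) × Fin (G.arity i) =>
      gen (G.scope q.1 q.2.1) * gen (G.scope q.1 q.2.2)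
        - gen (G.scope q.1 q.2.2) * gen (G.scope q.1 q.2.1))
  finite_rel := Set.toFinite _

variable {G} {dA dB : ℕ}

/-- Alice's observable for the `l`-th variable of the scope of constraint `i`. -/
def obsA (S : QStrategy G.Assign (fun _ : Fin n => Bool) dA dB) (i : Fin m)
    (l : Fin (G.arity i)) : Matrix (Fin dA) (Fin dA) ℂ :=
  ∑ α : G.Assign i, sgn (α l) • S.P i α

/-- Bob's observable for the variable `x_j`. -/
def obsB (S : QStrategy G.Assign (fun _ : Fin n => Bool) dA dB) (j : Fin n) :
    Matrix (Fin dB) (Fin dB) ℂ :=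
  ∑ b : Bool, sgn b • S.Q j b

end BCSGame

/-! ### XOR games -/

/-- An `m × n` XOR game: the players win on `(i, j)` if the XOR of their bits is `t i j`. -/
structure XORGame (m n : ℕ) where
  t : Fin m → Fin n → Bool
  prob : Fin m → Fin n → ℝ
  prob_nonneg : ∀ i j, 0 ≤ prob i j
  prob_sum : ∑ i, ∑ j, prob i j = 1

/-- A strategy for an XOR game: `±1`-valued observables and a shared state. -/
structure XORStrategy (m n dA dB : ℕ) where
  Y : Fin m → Matrix (Fin dA) (Fin dA) ℂ
  X : Fin n → Matrix (Fin dB) (Fin dB) ℂ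
  Y_herm : ∀ i, (Y i)ᴴ = Y i
  Y_sq : ∀ i, Y i * Y i = 1
  X_herm : ∀ j, (X j)ᴴ = X j
  X_sq : ∀ j, X j * X j = 1
  ψ : Fin dA × Fin dB → ℂ
  ψ_unit : star ψ ⬝ᵥ ψ = 1

namespace XORGame

variable {m n : ℕ} (G : XORGame m n)

/-- The cost matrix `g_ij = (-1)^{t_ij} π(i, j)`. -/
def cost (i : Fin m) (j : Fin n) : ℝ := if G.t i j then -G.prob i j else G.prob i j

/-- The bias of a strategy. -/
def bias {dA dB : ℕ} (S : XORStrategy m n dA dB) : ℝ :=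
  ∑ i, ∑ j, G.cost i j * expect S.ψ (S.Y i) (S.X j)

/-- The optimal bias, the supremum over all finite-dimensional strategies. The set is non-empty and
bounded by `1`. -/
def optimalBias : ℝ :=
  sSup {β : ℝ | ∃ (dA dB : ℕ) (S : XORStrategy m n dA dB), G.bias S = β}

/-- `δ`-optimal strategies. -/
def IsOptimalUpTo (δ : ℝ) {dA dB : ℕ} (S : XORStrategy m n dA dB) : Prop :=
  |G.bias S - G.optimalBias| ≤ δ

/-- `c` is the family of marginal row biases: every optimal strategy satisfies
`∑_j g_ij (1 ⊗ X_j) ψ = c_i (Y_i ⊗ 1) ψ` for all `i`. -/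
def IsRowBiases (c : Fin m → ℝ) : Prop :=
  ∀ (dA dB : ℕ) (S : XORStrategy m n dA dB), G.bias S = G.optimalBias → ∀ i,
    ∑ j, (G.cost i j : ℂ) • (((1 : Matrix (Fin dA) (Fin dA) ℂ) ⊗ₖ S.X j) *ᵥ S.ψ) =
      (c i : ℂ) • ((S.Y i ⊗ₖ (1 : Matrix (Fin dB) (Fin dB) ℂ)) *ᵥ S.ψ)

/-- The solution algebra, with generators `s_1, …, s_n`, for the row biases `c`. -/
def algebra (c : Fin m → ℝ) : StarPresentation (Fin n) where
  rel :=
    Set.range (fun j : Fin n => genStar j - gen j) ∪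
    Set.range (fun j : Fin n => gen j * gen j - 1) ∪
    Set.range (fun i : Fin m =>
      (∑ j, (G.cost i j : ℂ) • gen j) * (∑ j, (G.cost i j : ℂ) • gen j)
        - algebraMap ℂ (FreeStar (Fin n)) ((c i : ℂ) ^ 2))
  finite_rel := Set.toFinite _

end XORGame

end GameAlg

end

noncomputable section

namespace GameAlg

/-! ### The little Frobenius norm -/

section LittleFrob

variable {d : ℕ}

/-! All approximate representations of a presentation, over every dimension `d` and quality `ε`, are
treated at once as one family indexed by `Ω`. A constant depending only on the game is then an
`O(ε)` statement about families of matrices. The plan is to make the relations hold exactly in a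
quotient algebra, argue there as for an exact representation, and lift the resulting measurements
back to matrices.

The obstacle is that `φ s` has no bound on its operator norm, so a product with a factor small in
the little Frobenius norm need not be small. Truncating singular values at `1` (`exists_truncation`)
repairs this: a matrix of norm `O(ε)` is a contraction of norm `O(ε)` plus a matrix of rank `O(ε²
d)`, and low rank survives multiplication by anything. Such sums, the negligible families, form an
ideal among the tame families (bounded plus low rank). Nothing is lost on bounded families: a
bounded matrix of rank `O(ε² d)` has norm `O(ε)`, so there negligible means small (`cls_eq_iff`).

Generators are rounded to exact projections or involutions without any norm hypothesis
(`exists_projection_near`). Their classes satisfy the relations exactly (`lift_cls_eq_zero`), and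
projective measurements in the quotient lift to projective measurements
(`exists_measurement_cls_eq`). For synchronous games these are the rounded generators; for
constraint systems they are the joint spectral projections of involutions that commute in the
quotient. On the maximally entangled state a losing pair of answers has probability `‖P Q‖_f²`, the
square of an `O(ε)` quantity, whence the perfection `O(ε²)`.

For XOR games, strategies correspond to Gram matrices of real unit vectors, and Clifford matrices
realize all of them. At an optimal Gram matrix each row vector `∑_j g_ij v_j` is a multiple `c_i
u_i`. Midpoints of optimal Gram matrices are optimal, so the `c_i` do not depend on the optimum, and
they sum to the optimal bias. Rounding `c_i⁻¹ ∑_j g_ij s_j` to an involution loses `O(ε)` of the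
bias in each row. -/

theorem trace_conjTranspose_mul_self_re (A : Matrix (Fin d) (Fin d) ℂ) :
    (Aᴴ * A).trace.re = ∑ i, ∑ j, ‖A i j‖ ^ 2 := by
  rw [Finset.sum_comm]
  simp only [Matrix.trace, Matrix.diag, Matrix.mul_apply, Matrix.conjTranspose_apply,
    Complex.re_sum]
  refine Finset.sum_congr rfl fun i _ => Finset.sum_congr rfl fun j _ => ?_
  rw [← Complex.normSq_eq_norm_sq, Complex.star_def, mul_comm, Complex.mul_conj,
    Complex.ofReal_re]

theorem littleFrob_nonneg (A : Matrix (Fin d) (Fin d) ℂ) : 0 ≤ littleFrob A :=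
  Real.sqrt_nonneg _

theorem littleFrob_sq (A : Matrix (Fin d) (Fin d) ℂ) :
    littleFrob A ^ 2 = (∑ i, ∑ j, ‖A i j‖ ^ 2) / d := by
  rw [littleFrob, trace_conjTranspose_mul_self_re, Real.sq_sqrt]
  positivity

theorem littleFrob_sq_eq_trace (A : Matrix (Fin d) (Fin d) ℂ) :
    littleFrob A ^ 2 = (Aᴴ * A).trace.re / d := by
  rw [littleFrob_sq, trace_conjTranspose_mul_self_re]

attribute [local instance] Matrix.frobeniusSeminormedAddCommGroup
  Matrix.frobeniusNormedAddCommGroup Matrix.frobeniusNormedSpace in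
theorem littleFrob_eq_norm_div (A : Matrix (Fin d) (Fin d) ℂ) :
    littleFrob A = ‖A‖ / Real.sqrt d := by
  rw [littleFrob, trace_conjTranspose_mul_self_re, Matrix.frobenius_norm_def,
    Real.sqrt_div' _ (Nat.cast_nonneg d), Real.sqrt_eq_rpow]
  norm_cast

attribute [local instance] Matrix.frobeniusSeminormedAddCommGroup
  Matrix.frobeniusNormedAddCommGroup Matrix.frobeniusNormedSpace in
theorem littleFrob_add_le (A B : Matrix (Fin d) (Fin d) ℂ) :
    littleFrob (A + B) ≤ littleFrob A + littleFrob B := by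
  simp only [littleFrob_eq_norm_div, ← add_div]
  gcongr
  exact norm_add_le A B

attribute [local instance] Matrix.frobeniusSeminormedAddCommGroup
  Matrix.frobeniusNormedAddCommGroup Matrix.frobeniusNormedSpace in
theorem littleFrob_smul (c : ℂ) (A : Matrix (Fin d) (Fin d) ℂ) :
    littleFrob (c • A) = ‖c‖ * littleFrob A := by
  simp only [littleFrob_eq_norm_div, norm_smul, mul_div_assoc]

@[simp]
theorem littleFrob_zero : littleFrob (0 : Matrix (Fin d) (Fin d) ℂ) = 0 := by
  simp [littleFrob]

theorem littleFrob_neg (A : Matrix (Fin d) (Fin d) ℂ) : littleFrob (-A) = littleFrob A := by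
  simp [littleFrob]

theorem littleFrob_sub_comm (A B : Matrix (Fin d) (Fin d) ℂ) :
    littleFrob (A - B) = littleFrob (B - A) := by
  rw [← littleFrob_neg, neg_sub]

theorem littleFrob_sub_le (A B : Matrix (Fin d) (Fin d) ℂ) :
    littleFrob (A - B) ≤ littleFrob A + littleFrob B := by
  rw [sub_eq_add_neg, ← littleFrob_neg B]
  exact littleFrob_add_le A (-B)

theorem littleFrob_conjTranspose (A : Matrix (Fin d) (Fin d) ℂ) :
    littleFrob Aᴴ = littleFrob A := by
  rw [littleFrob, littleFrob, Matrix.conjTranspose_conjTranspose, Matrix.trace_mul_comm]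

theorem littleFrob_map_star (A : Matrix (Fin d) (Fin d) ℂ) :
    littleFrob (A.map star) = littleFrob A := by
  rw [← sq_eq_sq₀ (littleFrob_nonneg _) (littleFrob_nonneg _), littleFrob_sq, littleFrob_sq]
  simp

theorem littleFrob_map_star_sub (A B : Matrix (Fin d) (Fin d) ℂ) :
    littleFrob (A.map star - B.map star) = littleFrob (A - B) := by
  rw [← littleFrob_map_star (A - B)]
  congr 1
  ext s t
  simp

theorem littleFrob_unitary_mul {U : Matrix (Fin d) (Fin d) ℂ} (hU : Uᴴ * U = 1)
    (A : Matrix (Fin d) (Fin d) ℂ) : littleFrob (U * A) = littleFrob A := by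
  rw [littleFrob, littleFrob, Matrix.conjTranspose_mul, Matrix.mul_assoc, ← Matrix.mul_assoc Uᴴ,
    hU, Matrix.one_mul]

theorem littleFrob_mul_unitary {U : Matrix (Fin d) (Fin d) ℂ} (hU : U * Uᴴ = 1)
    (A : Matrix (Fin d) (Fin d) ℂ) : littleFrob (A * U) = littleFrob A := by
  rw [← littleFrob_conjTranspose, Matrix.conjTranspose_mul, littleFrob_unitary_mul,
    littleFrob_conjTranspose]
  rwa [Matrix.conjTranspose_conjTranspose]

theorem littleFrob_diagonal_sq (v : Fin d → ℂ) :
    littleFrob (Matrix.diagonal v) ^ 2 = (∑ i, ‖v i‖ ^ 2) / d := by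
  rw [littleFrob_sq]
  congr 1
  refine Finset.sum_congr rfl fun i _ => ?_
  rw [Finset.sum_eq_single i] <;> simp +contextual [eq_comm]

/-- The Cauchy–Schwarz inequality for the normalized Hilbert–Schmidt inner product. -/
theorem norm_trace_conjTranspose_mul_le (A B : Matrix (Fin d) (Fin d) ℂ) :
    ‖(Aᴴ * B).trace‖ / d ≤ littleFrob A * littleFrob B := by
  have h1 : ‖(Aᴴ * B).trace‖ ≤ ∑ p : Fin d × Fin d, ‖A p.1 p.2‖ * ‖B p.1 p.2‖ := by
    rw [Fintype.sum_prod_type_right]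
    simp only [Matrix.trace, Matrix.diag, Matrix.mul_apply, Matrix.conjTranspose_apply]
    refine (norm_sum_le _ _).trans (Finset.sum_le_sum fun i _ => ?_)
    refine (norm_sum_le _ _).trans (Finset.sum_le_sum fun j _ => ?_)
    simp
  have h2 := h1.trans (Real.sum_mul_le_sqrt_mul_sqrt _ _ _)
  rw [littleFrob, littleFrob, trace_conjTranspose_mul_self_re, trace_conjTranspose_mul_self_re,
    Real.sqrt_div' _ (Nat.cast_nonneg d), Real.sqrt_div' _ (Nat.cast_nonneg d), div_mul_div_comm,
    Real.mul_self_sqrt (Nat.cast_nonneg d)]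
  simp only [Fintype.sum_prod_type] at h2
  gcongr

end LittleFrob

/-! ### Operator bounds, through multiplication -/

section OpBound

variable {d : ℕ}

/-- `C` bounds the operator norm of `a`, expressed by left multiplication on the Hilbert–Schmidt
space. -/
def OpBound (C : ℝ) (a : Matrix (Fin d) (Fin d) ℂ) : Prop :=
  ∀ B, littleFrob (a * B) ≤ C * littleFrob B

theorem OpBound.add {C D : ℝ} {a b : Matrix (Fin d) (Fin d) ℂ} (ha : OpBound C a)
    (hb : OpBound D b) : OpBound (C + D) (a + b) := fun B => by
  rw [add_mul, add_mul]
  exact (littleFrob_add_le _ _).trans (add_le_add (ha B) (hb B))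

theorem OpBound.mul {C D : ℝ} (hC : 0 ≤ C) {a b : Matrix (Fin d) (Fin d) ℂ} (ha : OpBound C a)
    (hb : OpBound D b) : OpBound (C * D) (a * b) := fun B => by
  rw [mul_assoc, mul_assoc]
  exact (ha _).trans (mul_le_mul_of_nonneg_left (hb B) hC)

theorem opBound_smul_one (c : ℂ) : OpBound ‖c‖ (c • (1 : Matrix (Fin d) (Fin d) ℂ)) := fun B => by
  rw [smul_mul_assoc, one_mul, littleFrob_smul]

/-- Cauchy–Schwarz gives `‖a* B‖² = ⟨B, a a* B⟩ ≤ ‖B‖ · C ‖a* B‖`; cancel one factor. Through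
adjoints this turns bounds on left multiplication into bounds on right multiplication. -/
theorem OpBound.conjTranspose {C : ℝ} (hC : 0 ≤ C) {a : Matrix (Fin d) (Fin d) ℂ}
    (ha : OpBound C a) : OpBound C aᴴ := fun B => by
  have h1 : littleFrob (aᴴ * B) ^ 2 ≤ littleFrob B * (C * littleFrob (aᴴ * B)) := by
    rw [littleFrob_sq_eq_trace, Matrix.conjTranspose_mul, Matrix.conjTranspose_conjTranspose,
      Matrix.mul_assoc]
    calc (Bᴴ * (a * (aᴴ * B))).trace.re / d ≤ ‖(Bᴴ * (a * (aᴴ * B))).trace‖ / d := by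
          gcongr; exact Complex.re_le_norm _
      _ ≤ littleFrob B * littleFrob (a * (aᴴ * B)) := norm_trace_conjTranspose_mul_le _ _
      _ ≤ _ := mul_le_mul_of_nonneg_left (ha _) (littleFrob_nonneg _)
  rcases (littleFrob_nonneg (aᴴ * B)).eq_or_lt with h0 | h0
  · rw [← h0]; exact mul_nonneg hC (littleFrob_nonneg B)
  · refine le_of_mul_le_mul_right ?_ h0
    nlinarith

theorem OpBound.littleFrob_mul_le {C : ℝ} (hC : 0 ≤ C) {a : Matrix (Fin d) (Fin d) ℂ}
    (ha : OpBound C a) (B : Matrix (Fin d) (Fin d) ℂ) :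
    littleFrob (B * a) ≤ C * littleFrob B := by
  rw [← littleFrob_conjTranspose, Matrix.conjTranspose_mul, ← littleFrob_conjTranspose B]
  exact ha.conjTranspose hC _

theorem opBound_one_of_projection {p : Matrix (Fin d) (Fin d) ℂ} (h1 : pᴴ = p) (h2 : p * p = p) :
    OpBound 1 p := fun B => by
  have h3 : littleFrob (p * B) ^ 2 ≤ littleFrob B * littleFrob (p * B) := by
    rw [littleFrob_sq_eq_trace, Matrix.conjTranspose_mul, Matrix.mul_assoc, ← Matrix.mul_assoc pᴴ,
      h1, h2]
    refine le_trans ?_ (norm_trace_conjTranspose_mul_le _ _)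
    gcongr
    exact Complex.re_le_norm _
  rw [one_mul]
  rcases (littleFrob_nonneg (p * B)).eq_or_lt with h0 | h0
  · rw [← h0]; exact littleFrob_nonneg B
  · refine le_of_mul_le_mul_right ?_ h0
    rwa [← sq]

end OpBound

/-! ### Spectral rounding and truncation -/

section Spectral

variable {d : ℕ}

theorem exists_unitary_diagonalization {h : Matrix (Fin d) (Fin d) ℂ} (hh : hᴴ = h) :
    ∃ (U : Matrix (Fin d) (Fin d) ℂ) (v : Fin d → ℝ), Uᴴ * U = 1 ∧ U * Uᴴ = 1 ∧
      h = U * Matrix.diagonal (fun i => (v i : ℂ)) * Uᴴ := by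
  have hH : h.IsHermitian := hh
  refine ⟨hH.eigenvectorUnitary, hH.eigenvalues, ?_, ?_, ?_⟩
  · exact Unitary.coe_star_mul_self hH.eigenvectorUnitary
  · exact Unitary.coe_mul_star_self hH.eigenvectorUnitary
  · exact hH.spectral_theorem

/-- A diagonal `0`/`1` matrix, conjugated by a unitary, is a projection. -/
theorem conj_diagonal_ite_projection {U : Matrix (Fin d) (Fin d) ℂ} (hU : Uᴴ * U = 1)
    (p : Fin d → Prop) [DecidablePred p] :
    (U * Matrix.diagonal (fun i => if p i then (1 : ℂ) else 0) * Uᴴ)ᴴ =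
        U * Matrix.diagonal (fun i => if p i then (1 : ℂ) else 0) * Uᴴ ∧
      (U * Matrix.diagonal (fun i => if p i then (1 : ℂ) else 0) * Uᴴ) *
        (U * Matrix.diagonal (fun i => if p i then (1 : ℂ) else 0) * Uᴴ) =
        U * Matrix.diagonal (fun i => if p i then (1 : ℂ) else 0) * Uᴴ := by
  constructor
  · rw [Matrix.conjTranspose_mul, Matrix.conjTranspose_mul, Matrix.conjTranspose_conjTranspose,
      Matrix.diagonal_conjTranspose, Matrix.mul_assoc]
    congr 3
    ext i
    simp only [Pi.star_apply]
    split_ifs <;> simp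
  · calc _ = U * Matrix.diagonal (fun i => if p i then (1 : ℂ) else 0) * (Uᴴ * U) *
          Matrix.diagonal (fun i => if p i then (1 : ℂ) else 0) * Uᴴ := by
            simp only [Matrix.mul_assoc]
      _ = _ := by
        rw [hU, Matrix.mul_one, Matrix.mul_assoc U, Matrix.diagonal_mul_diagonal]
        congr 3
        ext i
        split_ifs <;> simp

/-- The distance `δ` from `l` to its rounding satisfies both `δ² ≤ |l² - l|` and `δ ≤ 2 |l² - l|`.
The first is used when `|e| ≤ κ`, the second otherwise. Here `κ` enters linearly because it will
itself be a sum of squares, whereas `e` must enter squared. -/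
theorem sq_dist_zero_one_le {l κ e : ℝ} (hκ : 0 ≤ κ) (h : l * l - l = κ + e) :
    (l - if 1 / 2 ≤ l then 1 else 0) ^ 2 ≤ 2 * κ + 16 * e ^ 2 := by
  have key : (l - if 1 / 2 ≤ l then 1 else 0) ^ 2 ≤ |l * l - l| ∧
      |l - if 1 / 2 ≤ l then 1 else 0| ≤ 2 * |l * l - l| := by
    split_ifs with h1
    · rcases le_total 1 l with h2 | h2
      · rw [abs_of_nonneg (by nlinarith : 0 ≤ l * l - l), abs_of_nonneg (by linarith)]
        constructor <;> nlinarith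
      · rw [abs_of_nonpos (by nlinarith : l * l - l ≤ 0), abs_of_nonpos (by linarith)]
        constructor <;> nlinarith
    · rw [not_le] at h1
      rcases le_total 0 l with h2 | h2
      · rw [abs_of_nonpos (by nlinarith : l * l - l ≤ 0), abs_of_nonneg (by linarith)]
        constructor <;> nlinarith
      · rw [abs_of_nonneg (by nlinarith : 0 ≤ l * l - l), abs_of_nonpos (by linarith)]
        constructor <;> nlinarith
  have h3 : |l * l - l| ≤ κ + |e| := by
    rw [h]; exact (abs_add_le _ _).trans (by rw [abs_of_nonneg hκ])
  rcases le_total |e| κ with h4 | h4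
  · nlinarith [key.1, sq_nonneg e]
  · have h5 : |l - if 1 / 2 ≤ l then 1 else 0| ≤ 4 * |e| := by linarith [key.2]
    have h6 := mul_self_le_mul_self (abs_nonneg _) h5
    rw [abs_mul_abs_self] at h6
    nlinarith [abs_mul_abs_self e]

/-- Rounding of a matrix whose Hermitian part is diagonal. -/
theorem littleFrob_diagonal_sub_round_sq_le (v : Fin d → ℝ) {k : Matrix (Fin d) (Fin d) ℂ}
    (hk : kᴴ = -k) :
    littleFrob (Matrix.diagonal (fun i => (v i : ℂ)) -
        Matrix.diagonal (fun i => if 1 / 2 ≤ v i then (1 : ℂ) else 0)) ^ 2 ≤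
      2 * littleFrob k ^ 2 + 16 * littleFrob
        ((Matrix.diagonal (fun i => (v i : ℂ)) + k) * (Matrix.diagonal (fun i => (v i : ℂ)) + k) -
          (Matrix.diagonal (fun i => (v i : ℂ)) + k)) ^ 2 := by
  set D : Matrix (Fin d) (Fin d) ℂ := Matrix.diagonal (fun i => (v i : ℂ)) with hD
  set E := (D + k) * (D + k) - (D + k) with hE
  have hk' : ∀ i j, star (k j i) = -k i j := fun i j => congrFun (congrFun hk i) j
  have hkre : ∀ i, (k i i).re = 0 := fun i => by
    have := congrArg Complex.re (hk' i i)
    simp at this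
    linarith
  -- Only diagonal entries are compared: those of `k` are purely imaginary, and those of `k * k` are
  -- minus the squared row norms of `k`. The real part of `E i i` therefore isolates `v i * v i - v
  -- i`.
  have hdiag : ∀ i, v i * v i - v i = (∑ j, ‖k i j‖ ^ 2) + (E i i).re := fun i => by
    have h1 : (k * k) i i = -((∑ j, ‖k i j‖ ^ 2 : ℝ) : ℂ) := by
      rw [Matrix.mul_apply]
      push_cast
      rw [← Finset.sum_neg_distrib]
      refine Finset.sum_congr rfl fun j _ => ?_
      rw [← neg_neg (k j i), ← hk' j i, Complex.star_def, mul_neg, Complex.mul_conj,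
        Complex.normSq_eq_norm_sq]
      push_cast
      ring
    have h2 : E = D * D + D * k + k * D + k * k - D - k := by rw [hE]; noncomm_ring
    have h3 : E i i = v i * v i + v i * k i i + k i i * v i + (k * k) i i - v i - k i i := by
      rw [h2, hD]
      simp [Matrix.diagonal_mul, Matrix.mul_diagonal]
    rw [h3, h1]
    simp only [Complex.sub_re, Complex.add_re, Complex.neg_re, Complex.ofReal_re, Complex.mul_re,
      Complex.ofReal_im, hkre i]
    ring
  rw [hD, Matrix.diagonal_sub, littleFrob_diagonal_sq, littleFrob_sq, littleFrob_sq,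
    mul_div_assoc', mul_div_assoc', ← add_div]
  gcongr
  rw [Finset.mul_sum, Finset.mul_sum, ← Finset.sum_add_distrib]
  refine Finset.sum_le_sum fun i _ => ?_
  have h4 := sq_dist_zero_one_le (Finset.sum_nonneg fun j _ => sq_nonneg ‖k i j‖) (hdiag i)
  have h5 : ‖(v i : ℂ) - if 1 / 2 ≤ v i then (1 : ℂ) else 0‖ ^ 2 =
      (v i - if 1 / 2 ≤ v i then 1 else 0) ^ 2 := by
    rw [← sq_abs (v i - _), ← Real.norm_eq_abs, ← Complex.norm_real]
    split_ifs <;> simp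
  have h6 : (E i i).re ^ 2 ≤ ∑ j, ‖E i j‖ ^ 2 := by
    refine le_trans ?_ (Finset.single_le_sum (f := fun j => ‖E i j‖ ^ 2)
      (fun j _ => sq_nonneg _) (Finset.mem_univ i))
    rw [← sq_abs]
    gcongr
    exact Complex.abs_re_le_norm _
  rw [h5]
  linarith

/-- An approximately self-adjoint and approximately idempotent matrix is close to a projection,
with no assumption on its operator norm. -/
theorem exists_projection_near (x : Matrix (Fin d) (Fin d) ℂ) :
    ∃ Q : Matrix (Fin d) (Fin d) ℂ, Qᴴ = Q ∧ Q * Q = Q ∧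
      littleFrob (Q - x) ≤ 4 * (littleFrob (x * x - x) + littleFrob (xᴴ - x)) ∧
      ∀ R : Matrix (Fin d) (Fin d) ℂ, R * x = 0 → R * xᴴ = 0 → R * Q = 0 := by
  set h : Matrix (Fin d) (Fin d) ℂ := (2⁻¹ : ℂ) • (x + xᴴ) with hdef
  set k : Matrix (Fin d) (Fin d) ℂ := (2⁻¹ : ℂ) • (x - xᴴ) with kdef
  have hx : x = h + k := by
    rw [hdef, kdef, ← smul_add]
    ext i j
    simp
    ring
  have hh : hᴴ = h := by
    rw [hdef, Matrix.conjTranspose_smul, Matrix.conjTranspose_add,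
      Matrix.conjTranspose_conjTranspose, add_comm]
    simp
  have hk : kᴴ = -k := by
    rw [kdef, Matrix.conjTranspose_smul, Matrix.conjTranspose_sub,
      Matrix.conjTranspose_conjTranspose, ← smul_neg, neg_sub]
    simp
  obtain ⟨U, v, hU1, hU2, hUv⟩ := exists_unitary_diagonalization hh
  set D : Matrix (Fin d) (Fin d) ℂ := Matrix.diagonal (fun i => (v i : ℂ)) with hD
  set χ : Matrix (Fin d) (Fin d) ℂ :=
    Matrix.diagonal (fun i => if 1 / 2 ≤ v i then (1 : ℂ) else 0) with hχ
  have hconj : ∀ A, littleFrob (U * A * Uᴴ) = littleFrob A := fun A => by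
    rw [littleFrob_mul_unitary (by rwa [Matrix.conjTranspose_conjTranspose]),
      littleFrob_unitary_mul hU1]
  have hkk : k = U * (Uᴴ * k * U) * Uᴴ := by
    calc k = (U * Uᴴ) * k * (U * Uᴴ) := by simp [hU2]
      _ = _ := by simp only [Matrix.mul_assoc]
  have hk' : (Uᴴ * k * U)ᴴ = -(Uᴴ * k * U) := by
    simp [Matrix.conjTranspose_mul, hk, Matrix.mul_assoc]
  obtain ⟨hQ1, hQ2⟩ := conj_diagonal_ite_projection hU1 (fun i => 1 / 2 ≤ v i)
  refine ⟨U * χ * Uᴴ, hQ1, hQ2, ?_, ?_⟩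
  · have hE : x * x - x = U * ((D + Uᴴ * k * U) * (D + Uᴴ * k * U) - (D + Uᴴ * k * U)) * Uᴴ := by
      have hxU : x = U * (D + Uᴴ * k * U) * Uᴴ := by
        rw [Matrix.mul_add, Matrix.add_mul, ← hUv, ← hkk, hx]
      calc x * x - x = (U * (D + Uᴴ * k * U) * Uᴴ) * (U * (D + Uᴴ * k * U) * Uᴴ) -
            U * (D + Uᴴ * k * U) * Uᴴ := by rw [← hxU]
        _ = U * ((D + Uᴴ * k * U) * (Uᴴ * U) * (D + Uᴴ * k * U)) * Uᴴ -
            U * (D + Uᴴ * k * U) * Uᴴ := by simp only [Matrix.mul_assoc]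
        _ = _ := by rw [hU1, Matrix.mul_one, Matrix.mul_sub, Matrix.sub_mul]
    have h1 := littleFrob_diagonal_sub_round_sq_le v hk'
    rw [← hconj (Uᴴ * k * U), ← hkk, ← hconj ((D + _) * _ - _), ← hE] at h1
    have h2 : littleFrob (U * χ * Uᴴ - h) = littleFrob (D - χ) := by
      rw [hUv, ← Matrix.sub_mul, ← Matrix.mul_sub, hconj, littleFrob_sub_comm]
    have h3 : littleFrob k = 2⁻¹ * littleFrob (xᴴ - x) := by
      rw [kdef, littleFrob_smul, littleFrob_sub_comm]
      norm_num
    -- Uses `2 a² + 16 b² ≤ (2 a + 4 b)²` for nonnegative `a` and `b`.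
    have h4 : littleFrob (D - χ) ≤ 2 * littleFrob k + 4 * littleFrob (x * x - x) := by
      refine abs_le_of_sq_le_sq' (h1.trans ?_) ?_ |>.2
      · nlinarith [mul_nonneg (littleFrob_nonneg k) (littleFrob_nonneg (x * x - x)),
          sq_nonneg (littleFrob k)]
      · linarith [littleFrob_nonneg k, littleFrob_nonneg (x * x - x)]
    have h5 : U * χ * Uᴴ - x = (U * χ * Uᴴ - h) - k := by rw [hx]; abel
    have h6 := littleFrob_sub_le (U * χ * Uᴴ - h) k
    rw [← h5, h2] at h6
    linarith [littleFrob_nonneg (xᴴ - x)]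
  · intro R hR1 hR2
    have hRh : R * h = 0 := by rw [hdef, Matrix.mul_smul, Matrix.mul_add, hR1, hR2]; simp
    have hRD : R * U * D = 0 := by
      calc R * U * D = R * U * D * (Uᴴ * U) := by rw [hU1, Matrix.mul_one]
        _ = R * (U * D * Uᴴ) * U := by simp only [Matrix.mul_assoc]
        _ = 0 := by rw [← hUv, hRh, Matrix.zero_mul]
    -- The rounding threshold `1 / 2` is positive, so `D` is invertible on the support of `χ`, and
    -- whatever annihilates `h` annihilates the projection exactly.
    have hχD : χ = D * Matrix.diagonal (fun i => if 1 / 2 ≤ v i then ((v i : ℂ))⁻¹ else 0) := by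
      rw [hD, Matrix.diagonal_mul_diagonal, hχ]
      congr 1
      ext i
      split_ifs with h1
      · rw [mul_inv_cancel₀]
        exact_mod_cast (by linarith : 0 < v i).ne'
      · simp
    rw [← Matrix.mul_assoc, ← Matrix.mul_assoc, hχD, ← Matrix.mul_assoc, hRD, Matrix.zero_mul,
      Matrix.zero_mul]

end Spectral

/-! ### Low-rank perturbations -/

section LowRank

variable {d : ℕ}

theorem rank_add_le (A B : Matrix (Fin d) (Fin d) ℂ) : (A + B).rank ≤ A.rank + B.rank := by
  have h : LinearMap.range (A + B).mulVecLin ≤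
      LinearMap.range A.mulVecLin ⊔ LinearMap.range B.mulVecLin := by
    rintro _ ⟨x, rfl⟩
    rw [Matrix.mulVecLin_add, LinearMap.add_apply]
    exact Submodule.add_mem_sup ⟨x, rfl⟩ ⟨x, rfl⟩
  exact (Submodule.finrank_mono h).trans (Submodule.finrank_add_le_finrank_add_finrank _ _)

theorem littleFrob_diagonal_ite_sq (p : Fin d → Prop) [DecidablePred p] :
    littleFrob (Matrix.diagonal (fun i => if p i then (1 : ℂ) else 0)) ^ 2 =
      (Fintype.card {i // p i} : ℝ) / d := by
  rw [littleFrob_diagonal_sq, Fintype.card_subtype, Finset.card_filter]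
  push_cast
  congr 1
  refine Finset.sum_congr rfl fun i _ => ?_
  split_ifs <;> simp

open scoped ComplexOrder in
/-- The projection onto the range of `b`. -/
theorem exists_range_projection (b : Matrix (Fin d) (Fin d) ℂ) :
    ∃ p : Matrix (Fin d) (Fin d) ℂ, pᴴ = p ∧ p * p = p ∧ p * b = b ∧
      littleFrob p ^ 2 = (b.rank : ℝ) / d := by
  obtain ⟨U, v, hU1, hU2, hUv⟩ :=
    exists_unitary_diagonalization (h := b * bᴴ) (by simp [Matrix.conjTranspose_mul])
  obtain ⟨h1, h2⟩ := conj_diagonal_ite_projection hU1 (fun i => v i ≠ 0)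
  refine ⟨_, h1, h2, ?_, ?_⟩
  · have h3 : (1 - U * Matrix.diagonal (fun i => if v i ≠ 0 then (1 : ℂ) else 0) * Uᴴ) * b * bᴴ
        = 0 := by
      rw [Matrix.mul_assoc, Matrix.sub_mul, Matrix.one_mul, hUv, sub_eq_zero]
      calc _ = U * (Matrix.diagonal (fun i => if v i ≠ 0 then (1 : ℂ) else 0) *
              Matrix.diagonal (fun i => (v i : ℂ))) * Uᴴ := by
            rw [Matrix.diagonal_mul_diagonal]
            congr 3
            ext i
            split_ifs with h <;> simp_all
        _ = U * (Matrix.diagonal (fun i => if v i ≠ 0 then (1 : ℂ) else 0) * (Uᴴ * U) *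
              Matrix.diagonal (fun i => (v i : ℂ))) * Uᴴ := by rw [hU1, Matrix.mul_one]
        _ = _ := by simp only [Matrix.mul_assoc]
    rw [Matrix.mul_assoc, Matrix.mul_self_mul_conjTranspose_eq_zero, Matrix.sub_mul, Matrix.one_mul,
      sub_eq_zero] at h3
    exact h3.symm
  · rw [littleFrob_mul_unitary (by rwa [Matrix.conjTranspose_conjTranspose]),
      littleFrob_unitary_mul hU1, littleFrob_diagonal_ite_sq,
      ← Matrix.rank_self_mul_conjTranspose, hUv,
      Matrix.rank_mul_eq_left_of_isUnit_det _ _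
        (Matrix.isUnit_det_of_left_inverse (B := U) hU2),
      Matrix.rank_mul_eq_right_of_isUnit_det _ _ (Matrix.isUnit_det_of_left_inverse hU1),
      Matrix.rank_diagonal]
    simp

theorem trace_conjTranspose_mul_diagonal_mul_re (w : Fin d → ℝ)
    (B : Matrix (Fin d) (Fin d) ℂ) :
    (Bᴴ * (Matrix.diagonal (fun i => (w i : ℂ)) * B)).trace.re = ∑ i, ∑ j, w i * ‖B i j‖ ^ 2 := by
  rw [Finset.sum_comm]
  simp only [Matrix.trace, Matrix.diag, Matrix.mul_apply (M := Bᴴ), Matrix.conjTranspose_apply,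
    Matrix.diagonal_mul, Complex.re_sum]
  refine Finset.sum_congr rfl fun i _ => Finset.sum_congr rfl fun j _ => ?_
  rw [mul_left_comm, Complex.re_ofReal_mul, ← Complex.normSq_eq_norm_sq, Complex.star_def,
    mul_comm (starRingEnd ℂ _), Complex.mul_conj, Complex.ofReal_re]

/-- Truncation at singular value `1`: a matrix which is small in Hilbert–Schmidt norm is the sum of
a matrix of operator norm at most `1` and a matrix of small rank. -/
theorem exists_truncation (u : Matrix (Fin d) (Fin d) ℂ) :
    ∃ a b : Matrix (Fin d) (Fin d) ℂ, u = a + b ∧ OpBound 1 a ∧ littleFrob a ≤ littleFrob u ∧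
      (b.rank : ℝ) ≤ littleFrob u ^ 2 * d := by
  obtain ⟨U, v, hU1, hU2, hUv⟩ :=
    exists_unitary_diagonalization (h := uᴴ * u) (by simp [Matrix.conjTranspose_mul])
  have hD : (u * U)ᴴ * (u * U) = Matrix.diagonal (fun i => (v i : ℂ)) := by
    calc (u * U)ᴴ * (u * U) = Uᴴ * (uᴴ * u) * U := by
          simp only [Matrix.conjTranspose_mul, Matrix.mul_assoc]
      _ = (Uᴴ * U) * Matrix.diagonal (fun i => (v i : ℂ)) * (Uᴴ * U) := by
          rw [hUv]; simp only [Matrix.mul_assoc]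
      _ = _ := by rw [hU1, Matrix.one_mul, Matrix.mul_one]
  have hv : ∀ i, v i = ∑ j, ‖(u * U) j i‖ ^ 2 := fun i => by
    have h1 := congrArg Complex.re (congrFun (congrFun hD i) i)
    rw [Matrix.diagonal_apply_eq, Complex.ofReal_re, Matrix.mul_apply, Complex.re_sum] at h1
    rw [← h1]
    refine Finset.sum_congr rfl fun j _ => ?_
    rw [Matrix.conjTranspose_apply, ← Complex.normSq_eq_norm_sq, Complex.star_def,
      mul_comm, Complex.mul_conj, Complex.ofReal_re]
  -- Split by the spectral projection `V` of `uᴴ * u` for eigenvalues at most `1`. The rank of `u *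
  -- (1 - V)` is at most the number of eigenvalues above `1`, which by Markov's inequality is at
  -- most their total sum `littleFrob u ^ 2 * d`.
  obtain ⟨h1, h2⟩ := conj_diagonal_ite_projection hU1 (fun i => v i ≤ 1)
  set V := U * Matrix.diagonal (fun i => if v i ≤ 1 then (1 : ℂ) else 0) * Uᴴ with hV
  refine ⟨u * V, u * (1 - V), by rw [Matrix.mul_sub, Matrix.mul_one, add_sub_cancel], ?_, ?_, ?_⟩
  · intro B
    rw [one_mul, ← littleFrob_unitary_mul (U := Uᴴ)
      (by rwa [Matrix.conjTranspose_conjTranspose]) B]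
    refine abs_le_of_sq_le_sq' ?_ (littleFrob_nonneg _) |>.2
    have h3 : (u * V * B)ᴴ * (u * V * B) = (Uᴴ * B)ᴴ *
        (Matrix.diagonal (fun i => ((if v i ≤ 1 then v i else 0 : ℝ) : ℂ)) * (Uᴴ * B)) := by
      have h4 : Matrix.diagonal (fun i => ((if v i ≤ 1 then v i else 0 : ℝ) : ℂ)) =
          Matrix.diagonal (fun i => if v i ≤ 1 then (1 : ℂ) else 0) * ((u * U)ᴴ * (u * U)) *
            Matrix.diagonal (fun i => if v i ≤ 1 then (1 : ℂ) else 0) := by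
        rw [hD, Matrix.diagonal_mul_diagonal, Matrix.diagonal_mul_diagonal]
        congr 1
        ext i
        split_ifs <;> simp
      have h5 : (Matrix.diagonal (fun i => if v i ≤ 1 then (1 : ℂ) else 0))ᴴ =
          Matrix.diagonal (fun i => if v i ≤ 1 then (1 : ℂ) else 0) := by
        rw [Matrix.diagonal_conjTranspose]
        congr 1
        ext i
        simp only [Pi.star_apply]
        split_ifs <;> simp
      rw [h4, hV]
      simp only [Matrix.conjTranspose_mul, h5, Matrix.conjTranspose_conjTranspose,
        Matrix.mul_assoc]
    rw [littleFrob_sq_eq_trace, h3, trace_conjTranspose_mul_diagonal_mul_re, littleFrob_sq]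
    gcongr with i _ j _
    have h6 : (if v i ≤ 1 then v i else 0) ≤ 1 := by split_ifs <;> linarith
    nlinarith [sq_nonneg ‖(Uᴴ * B) i j‖]
  · simpa using (opBound_one_of_projection h1 h2).littleFrob_mul_le zero_le_one u
  · have h3 : 1 - V = U * Matrix.diagonal (fun i => if v i ≤ 1 then (0 : ℂ) else 1) * Uᴴ := by
      have h4 : Matrix.diagonal (fun i => if v i ≤ 1 then (0 : ℂ) else 1) =
          1 - Matrix.diagonal (fun i => if v i ≤ 1 then (1 : ℂ) else 0) := by
        rw [← Matrix.diagonal_one, Matrix.diagonal_sub]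
        congr 1
        ext i
        split_ifs <;> simp
      rw [h4, Matrix.mul_sub, Matrix.sub_mul, Matrix.mul_one, hU2]
    have h4 : (u * (1 - V)).rank ≤ Fintype.card {i // ¬ v i ≤ 1} := by
      refine (Matrix.rank_mul_le_right _ _).trans ?_
      rw [h3]
      refine (Matrix.rank_mul_le_left _ _).trans ((Matrix.rank_mul_le_right _ _).trans ?_)
      rw [Matrix.rank_diagonal]
      exact le_of_eq (Fintype.card_congr (Equiv.subtypeEquivRight fun i => by simp))
    have h5 : (Fintype.card {i // ¬ v i ≤ 1} : ℝ) ≤ ∑ i, v i := by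
      rw [Fintype.card_subtype, Finset.card_filter]
      push_cast
      refine Finset.sum_le_sum fun i _ => ?_
      have h6 : 0 ≤ v i := by rw [hv]; positivity
      split_ifs <;> linarith
    have h7 : ∑ i, v i = littleFrob u ^ 2 * d := by
      rw [← littleFrob_mul_unitary hU2 u, littleFrob_sq, Finset.sum_comm]
      simp only [← hv]
      rcases Nat.eq_zero_or_pos d with rfl | hd
      · simp
      · field_simp
    rw [← h7]
    exact le_trans (by exact_mod_cast h4) h5

/-- A matrix of bounded operator norm which is small up to a matrix of small rank is small. -/
theorem OpBound.littleFrob_add_lowRank_le {C : ℝ} (hC : 0 ≤ C) {a b : Matrix (Fin d) (Fin d) ℂ}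
    (h : OpBound C (a + b)) :
    littleFrob (a + b) ≤ littleFrob a + C * Real.sqrt (b.rank / d) := by
  obtain ⟨p, h1, h2, h3, h4⟩ := exists_range_projection b
  -- Off the range of `b` only `a` is seen; on it the whole matrix is bounded by `C` times the norm
  -- of the projection `p`.
  have h5 : a + b = (1 - p) * a + p * (a + b) := by
    rw [Matrix.sub_mul, Matrix.one_mul, Matrix.mul_add, h3]; abel
  have h6 : OpBound 1 (1 - p) := opBound_one_of_projection (by simp [h1])
    (by simp [Matrix.sub_mul, Matrix.mul_sub, h2])
  have h7 : littleFrob p = Real.sqrt (b.rank / d) := by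
    rw [← h4, Real.sqrt_sq (littleFrob_nonneg p)]
  rw [h5]
  refine (littleFrob_add_le _ _).trans (add_le_add ?_ ?_)
  · simpa using h6 a
  · rw [← h7]
    exact h.littleFrob_mul_le hC p

end LowRank

/-! ### Families of matrices modulo asymptotically small ones

The estimates below are uniform over a family of pairs `(d, ε)`. A family of matrices is *small* if
its little Frobenius norm is `O(ε)`, and of *low rank* if its rank is `O(ε² d)`. -/

/-- The matrices indexed by a family of dimensions. -/
abbrev Fam {Ω : Type*} (d : Ω → ℕ) : Type _ := ∀ ω, Matrix (Fin (d ω)) (Fin (d ω)) ℂ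

section Families

variable {Ω : Type*} {d : Ω → ℕ}

/-- The family has uniformly bounded operator norms. -/
def BddFam (x : Fam d) : Prop := ∃ C : ℝ, 0 ≤ C ∧ ∀ ω, OpBound C (x ω)

/-- The little Frobenius norms are `O(ε)`. -/
def SmallFam (ε : Ω → ℝ) (x : Fam d) : Prop :=
  ∃ C : ℝ, 0 ≤ C ∧ ∀ ω, littleFrob (x ω) ≤ C * ε ω

/-- The ranks are `O(ε² d)`. -/
def LowRankFam (ε : Ω → ℝ) (x : Fam d) : Prop :=
  ∃ C : ℝ, 0 ≤ C ∧ ∀ ω, ((x ω).rank : ℝ) ≤ C * (ε ω ^ 2 * d ω)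

theorem BddFam.add {x y : Fam d} (hx : BddFam x) (hy : BddFam y) : BddFam (x + y) := by
  obtain ⟨C, hC, hx⟩ := hx
  obtain ⟨D, hD, hy⟩ := hy
  exact ⟨C + D, add_nonneg hC hD, fun ω => (hx ω).add (hy ω)⟩

theorem BddFam.mul {x y : Fam d} (hx : BddFam x) (hy : BddFam y) : BddFam (x * y) := by
  obtain ⟨C, hC, hx⟩ := hx
  obtain ⟨D, hD, hy⟩ := hy
  exact ⟨C * D, mul_nonneg hC hD, fun ω => (hx ω).mul hC (hy ω)⟩

theorem bddFam_smul_one (c : ℂ) : BddFam (c • (1 : Fam d)) :=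
  ⟨‖c‖, norm_nonneg c, fun _ => opBound_smul_one c⟩

theorem bddFam_one : BddFam (1 : Fam d) := by
  simpa using bddFam_smul_one (d := d) 1

theorem BddFam.smul (c : ℂ) {x : Fam d} (hx : BddFam x) : BddFam (c • x) := by
  simpa using (bddFam_smul_one c).mul hx

theorem BddFam.neg {x : Fam d} (hx : BddFam x) : BddFam (-x) := by
  simpa using hx.smul (-1)

theorem BddFam.sub {x y : Fam d} (hx : BddFam x) (hy : BddFam y) : BddFam (x - y) := by
  rw [sub_eq_add_neg]
  exact hx.add hy.neg

theorem BddFam.star {x : Fam d} (hx : BddFam x) : BddFam (star x) := by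
  obtain ⟨C, hC, hx⟩ := hx
  exact ⟨C, hC, fun ω => (hx ω).conjTranspose hC⟩

theorem bddFam_of_projection {p : Fam d} (h1 : star p = p) (h2 : p * p = p) : BddFam p :=
  ⟨1, zero_le_one, fun ω => opBound_one_of_projection (congrFun h1 ω) (congrFun h2 ω)⟩

variable {ε : Ω → ℝ}

theorem SmallFam.add {x y : Fam d} (hx : SmallFam ε x) (hy : SmallFam ε y) :
    SmallFam ε (x + y) := by
  obtain ⟨C, hC, hx⟩ := hx
  obtain ⟨D, hD, hy⟩ := hy
  refine ⟨C + D, add_nonneg hC hD, fun ω => ?_⟩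
  rw [add_mul]
  exact (littleFrob_add_le _ _).trans (add_le_add (hx ω) (hy ω))

theorem SmallFam.mul_left {x y : Fam d} (hx : BddFam x) (hy : SmallFam ε y) :
    SmallFam ε (x * y) := by
  obtain ⟨C, hC, hx⟩ := hx
  obtain ⟨D, hD, hy⟩ := hy
  refine ⟨C * D, mul_nonneg hC hD, fun ω => ?_⟩
  rw [mul_assoc]
  exact (hx ω _).trans (mul_le_mul_of_nonneg_left (hy ω) hC)

theorem SmallFam.mul_right {x y : Fam d} (hx : SmallFam ε x) (hy : BddFam y) :
    SmallFam ε (x * y) := by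
  obtain ⟨C, hC, hx⟩ := hx
  obtain ⟨D, hD, hy⟩ := hy
  refine ⟨D * C, mul_nonneg hD hC, fun ω => ?_⟩
  rw [mul_assoc]
  exact ((hy ω).littleFrob_mul_le hD _).trans (mul_le_mul_of_nonneg_left (hx ω) hD)

theorem SmallFam.smul (c : ℂ) {x : Fam d} (hx : SmallFam ε x) : SmallFam ε (c • x) := by
  simpa using hx.mul_left (bddFam_smul_one c)

theorem SmallFam.neg {x : Fam d} (hx : SmallFam ε x) : SmallFam ε (-x) := by
  simpa using hx.smul (-1)

theorem SmallFam.star {x : Fam d} (hx : SmallFam ε x) : SmallFam ε (star x) := by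
  obtain ⟨C, hC, hx⟩ := hx
  exact ⟨C, hC, fun ω => (littleFrob_conjTranspose (x ω)).trans_le (hx ω)⟩

theorem smallFam_zero : SmallFam ε (0 : Fam d) :=
  ⟨0, le_rfl, fun ω => by simp⟩

/-- A constant that works for finitely many small families. -/
theorem exists_uniform_of_smallFam {ι : Type*} [Finite ι] (hε : ∀ ω, 0 ≤ ε ω) {x : ι → Fam d}
    (hx : ∀ k, SmallFam ε (x k)) : ∃ C : ℝ, 0 ≤ C ∧ ∀ k ω, littleFrob (x k ω) ≤ C * ε ω := by
  have := Fintype.ofFinite ι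
  choose C hC hx using hx
  refine ⟨∑ k, C k, Finset.sum_nonneg fun k _ => hC k, fun k ω => (hx k ω).trans ?_⟩
  exact mul_le_mul_of_nonneg_right
    (Finset.single_le_sum (fun k _ => hC k) (Finset.mem_univ k)) (hε ω)

theorem LowRankFam.add {x y : Fam d} (hx : LowRankFam ε x) (hy : LowRankFam ε y) :
    LowRankFam ε (x + y) := by
  obtain ⟨C, hC, hx⟩ := hx
  obtain ⟨D, hD, hy⟩ := hy
  refine ⟨C + D, add_nonneg hC hD, fun ω => ?_⟩
  have h : (((x ω + y ω).rank : ℕ) : ℝ) ≤ (x ω).rank + (y ω).rank := by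
    exact_mod_cast rank_add_le (x ω) (y ω)
  rw [add_mul]
  exact h.trans (add_le_add (hx ω) (hy ω))

theorem LowRankFam.mul_left (x : Fam d) {y : Fam d} (hy : LowRankFam ε y) :
    LowRankFam ε (x * y) := by
  obtain ⟨C, hC, hy⟩ := hy
  exact ⟨C, hC, fun ω => le_trans (by exact_mod_cast Matrix.rank_mul_le_right _ _) (hy ω)⟩

theorem LowRankFam.mul_right {x : Fam d} (hx : LowRankFam ε x) (y : Fam d) :
    LowRankFam ε (x * y) := by
  obtain ⟨C, hC, hx⟩ := hx
  exact ⟨C, hC, fun ω => le_trans (by exact_mod_cast Matrix.rank_mul_le_left _ _) (hx ω)⟩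

theorem lowRankFam_zero : LowRankFam ε (0 : Fam d) :=
  ⟨0, le_rfl, fun ω => by simp⟩

/-! ### The ideal of negligible families and its quotient algebra. -/

variable (ε)

/-- Negligible families: small, bounded families up to families of low rank. -/
def NegligibleFam (x : Fam d) : Prop :=
  ∃ a b : Fam d, x = a + b ∧ BddFam a ∧ SmallFam ε a ∧ LowRankFam ε b

variable (d) in
/-- The algebra of families that are bounded up to a family of low rank. -/
def tameFam : Subalgebra ℂ (Fam d) where
  carrier := {x | ∃ a b : Fam d, x = a + b ∧ BddFam a ∧ LowRankFam ε b}
  mul_mem' := by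
    rintro _ _ ⟨a, b, rfl, ha, hb⟩ ⟨a', b', rfl, ha', hb'⟩
    -- Every term containing `b` or `b'` has low rank, whatever the norm of the other factor.
    refine ⟨a * a', a * b' + b * (a' + b'), by noncomm_ring, ha.mul ha', ?_⟩
    exact (hb'.mul_left a).add (hb.mul_right _)
  add_mem' := by
    rintro _ _ ⟨a, b, rfl, ha, hb⟩ ⟨a', b', rfl, ha', hb'⟩
    exact ⟨a + a', b + b', by abel, ha.add ha', hb.add hb'⟩
  algebraMap_mem' c :=
    ⟨algebraMap ℂ _ c, 0, by simp, by
      rw [Algebra.algebraMap_eq_smul_one]; exact bddFam_smul_one c, lowRankFam_zero⟩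

variable {ε}

theorem BddFam.mem_tameFam {x : Fam d} (hx : BddFam x) : x ∈ tameFam d ε :=
  ⟨x, 0, by simp, hx, lowRankFam_zero⟩

theorem NegligibleFam.mem_tameFam {x : Fam d} (hx : NegligibleFam ε x) : x ∈ tameFam d ε := by
  obtain ⟨a, b, h, ha, _, hb⟩ := hx
  exact ⟨a, b, h, ha, hb⟩

theorem NegligibleFam.add {x y : Fam d} (hx : NegligibleFam ε x) (hy : NegligibleFam ε y) :
    NegligibleFam ε (x + y) := by
  obtain ⟨a, b, rfl, h1, h2, h3⟩ := hx
  obtain ⟨a', b', rfl, h1', h2', h3'⟩ := hy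
  exact ⟨a + a', b + b', by abel, h1.add h1', h2.add h2', h3.add h3'⟩

/-- The small summand is only ever multiplied by a bounded family, and all other terms have low
rank. This ideal property fails for `SmallFam` alone, since a tame factor may be unbounded. -/
theorem NegligibleFam.mul_left {x y : Fam d} (hx : x ∈ tameFam d ε) (hy : NegligibleFam ε y) :
    NegligibleFam ε (x * y) := by
  obtain ⟨a, b, rfl, h1, h2⟩ := hx
  obtain ⟨a', b', rfl, h1', h2', h3'⟩ := hy
  exact ⟨a * a', a * b' + b * (a' + b'), by noncomm_ring, h1.mul h1', h2'.mul_left h1,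
    (h3'.mul_left a).add (h2.mul_right _)⟩

theorem NegligibleFam.mul_right {x y : Fam d} (hx : NegligibleFam ε x) (hy : y ∈ tameFam d ε) :
    NegligibleFam ε (x * y) := by
  obtain ⟨a, b, rfl, h1, h2, h3⟩ := hx
  obtain ⟨a', b', rfl, h1', h2'⟩ := hy
  exact ⟨a * a', a * b' + b * (a' + b'), by noncomm_ring, h1.mul h1', h2.mul_right h1',
    (h2'.mul_left a).add (h3.mul_right _)⟩

theorem negligibleFam_zero : NegligibleFam ε (0 : Fam d) :=
  ⟨0, 0, by simp, by simpa using bddFam_smul_one (d := d) 0, smallFam_zero, lowRankFam_zero⟩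

theorem NegligibleFam.neg {x : Fam d} (hx : NegligibleFam ε x) : NegligibleFam ε (-x) := by
  simpa using hx.mul_left (bddFam_one.neg.mem_tameFam (ε := ε))

/-- Truncation at every index; the rank bound `littleFrob (x ω) ^ 2 * d ω` becomes `C ^ 2 * (ε ω ^ 2
* d ω)`. -/
theorem SmallFam.negligible {x : Fam d} (hx : SmallFam ε x) : NegligibleFam ε x := by
  obtain ⟨C, hC, hx⟩ := hx
  choose a b h1 h2 h3 h4 using fun ω => exists_truncation (x ω)
  refine ⟨a, b, funext h1, ⟨1, zero_le_one, h2⟩, ⟨C, hC, fun ω => (h3 ω).trans (hx ω)⟩,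
    ⟨C ^ 2, sq_nonneg C, fun ω => (h4 ω).trans ?_⟩⟩
  rw [← mul_assoc, ← mul_pow]
  gcongr
  · exact littleFrob_nonneg _
  · exact hx ω

/-- A low-rank part of rank `D ε² d` costs a matrix of operator norm at most `K` no more than `K √(D
ε²) = K √D ε`. The rank scale `ε² d` is chosen to match the norm scale `ε`. -/
theorem BddFam.smallFam_of_negligible (hε : ∀ ω, 0 ≤ ε ω) {x : Fam d} (hx : BddFam x)
    (h : NegligibleFam ε x) : SmallFam ε x := by
  obtain ⟨K, hK, hx⟩ := hx
  obtain ⟨a, b, rfl, -, ⟨C, hC, h1⟩, ⟨D, hD, h2⟩⟩ := h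
  refine ⟨C + K * Real.sqrt D, by positivity, fun ω => ?_⟩
  refine ((hx ω).littleFrob_add_lowRank_le hK).trans ?_
  rw [add_mul, mul_assoc]
  refine add_le_add (h1 ω) (mul_le_mul_of_nonneg_left ?_ hK)
  rw [← Real.sqrt_sq (hε ω), ← Real.sqrt_mul hD]
  refine Real.sqrt_le_sqrt (div_le_of_le_mul₀ (Nat.cast_nonneg _) (by positivity) ?_)
  linarith [h2 ω]

variable (d ε) in
/-- Equality up to negligible families. -/
def negligibleCon : RingCon (tameFam d ε) where
  r x y := NegligibleFam ε ((x : Fam d) - (y : Fam d))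
  iseqv :=
    { refl := fun x => by simpa using negligibleFam_zero
      symm := fun {x y} h => by simpa using h.neg
      trans := fun {x y z} h h' => by simpa using h.add h' }
  mul' {w x y z} h h' := by
    have : ((w * y : tameFam d ε) : Fam d) - (x * z : tameFam d ε) =
        ((w : Fam d) - x) * y + x * ((y : Fam d) - z) := by
      push_cast; noncomm_ring
    rw [this]
    exact (h.mul_right y.2).add (h'.mul_left x.2)
  add' {w x y z} h h' := by
    have : ((w + y : tameFam d ε) : Fam d) - (x + z : tameFam d ε) =
        ((w : Fam d) - x) + ((y : Fam d) - z) := by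
      push_cast; abel
    rw [this]
    exact h.add h'

variable (d ε) in
/-- The algebra of tame families modulo negligible ones. -/
def AsymAlg : Type _ := (negligibleCon d ε).Quotient

instance : Ring (AsymAlg d ε) := inferInstanceAs (Ring (negligibleCon d ε).Quotient)

instance : Algebra ℂ (AsymAlg d ε) := inferInstanceAs (Algebra ℂ (negligibleCon d ε).Quotient)

variable (d ε) in
/-- The class of a tame family. -/
def asymMk : tameFam d ε →ₐ[ℂ] AsymAlg d ε :=
  { (negligibleCon d ε).mk' with commutes' := fun _ => rfl }

theorem asymMk_eq_iff {x y : tameFam d ε} :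
    asymMk d ε x = asymMk d ε y ↔ NegligibleFam ε ((x : Fam d) - (y : Fam d)) :=
  (negligibleCon d ε).eq

variable (d) in
/-- The `*`-algebra of bounded families. -/
def bddFam : StarSubalgebra ℂ (Fam d) where
  carrier := {x | BddFam x}
  mul_mem' := BddFam.mul
  add_mem' := BddFam.add
  algebraMap_mem' c := by
    rw [Set.mem_ofPred, Algebra.algebraMap_eq_smul_one]
    exact bddFam_smul_one c
  star_mem' := BddFam.star

variable (d ε) in
/-- The class of a bounded family. -/
def cls : bddFam d →ₐ[ℂ] AsymAlg d ε :=
  (asymMk d ε).comp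
    (Subalgebra.inclusion (S := (bddFam d).toSubalgebra) fun _ hx => BddFam.mem_tameFam hx)

/-- The bridge between exact algebra and estimates: truncation shows that small implies negligible,
and boundedness gives the converse. -/
theorem cls_eq_iff (hε : ∀ ω, 0 ≤ ε ω) {x y : bddFam d} :
    cls d ε x = cls d ε y ↔ SmallFam ε ((x : Fam d) - (y : Fam d)) :=
  asymMk_eq_iff.trans
    ⟨fun h => (BddFam.sub x.2 y.2).smallFam_of_negligible hε h, fun h => h.negligible⟩

theorem cls_eq_zero_iff (hε : ∀ ω, 0 ≤ ε ω) {x : bddFam d} :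
    cls d ε x = 0 ↔ SmallFam ε (x : Fam d) := by
  rw [← map_zero (cls d ε), cls_eq_iff hε]
  simp

/-! ### Transfer of relations -/

/-- The value of a `*`-polynomial at a family. -/
def evalFam {S : Type*} (φ : S → Fam d) : FreeStar S →ₐ[ℂ] Fam d :=
  FreeAlgebra.lift ℂ (Sum.elim φ (fun s => star (φ s)))

theorem evalFam_apply {S : Type*} (φ : S → Fam d) (r : FreeStar S) (ω : Ω) :
    evalFam φ r ω = evalStar (fun s => φ s ω) r := by
  have h : (Pi.evalAlgHom ℂ (fun ω => Matrix (Fin (d ω)) (Fin (d ω)) ℂ) ω).comp (evalFam φ) =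
      evalStar (fun s => φ s ω) := by
    refine FreeAlgebra.hom_ext (funext fun s => ?_)
    rcases s with s | s <;> simp [evalFam, evalStar, Matrix.star_eq_conjTranspose]
  exact DFunLike.congr_fun h r

/-- If the `*`-polynomial `r` is small at `φ`, and `φ` is close to a bounded self-adjoint family
`X`, then `r` vanishes at the classes of `X`. -/
theorem lift_cls_eq_zero {S : Type*} {φ : S → Fam d} {X : S → bddFam d}
    (hX : ∀ s, star (X s) = X s) (hφ : ∀ s, SmallFam ε ((X s : Fam d) - φ s)) {r : FreeStar S}
    (hr : SmallFam ε (evalFam φ r)) :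
    FreeAlgebra.lift ℂ (Sum.elim (fun s => cls d ε (X s)) (fun s => cls d ε (X s))) r = 0 := by
  have hφN : ∀ s, NegligibleFam ε (φ s - (X s : Fam d)) := fun s => by
    simpa using (hφ s).negligible.neg
  have hφN' : ∀ s, NegligibleFam ε (star (φ s) - (X s : Fam d)) := fun s => by
    have h := (hφ s).star.negligible.neg
    rwa [star_sub, neg_sub, ← StarMemClass.coe_star, hX] at h
  have hXt : ∀ s, (X s : Fam d) ∈ tameFam d ε := fun s => BddFam.mem_tameFam (X s).2
  -- `φ s` may be unbounded, but it is the bounded `X s` plus a negligible error. It therefore lies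
  -- in the algebra where the quotient map is multiplicative, and has the same class as `X s`.
  have ht : ∀ s, φ s ∈ tameFam d ε := fun s => by
    simpa using (tameFam d ε).add_mem (hφN s).mem_tameFam (hXt s)
  have ht' : ∀ s, star (φ s) ∈ tameFam d ε := fun s => by
    simpa using (tameFam d ε).add_mem (hφN' s).mem_tameFam (hXt s)
  let Φ : FreeStar S →ₐ[ℂ] tameFam d ε :=
    FreeAlgebra.lift ℂ (Sum.elim (fun s => ⟨φ s, ht s⟩) (fun s => ⟨star (φ s), ht' s⟩))
  have h1 : (tameFam d ε).val.comp Φ = evalFam φ := by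
    refine FreeAlgebra.hom_ext (funext fun s => ?_)
    rcases s with s | s <;> simp [Φ, evalFam]
  have h2 : (asymMk d ε).comp Φ =
      FreeAlgebra.lift ℂ (Sum.elim (fun s => cls d ε (X s)) (fun s => cls d ε (X s))) := by
    refine FreeAlgebra.hom_ext (funext fun s => ?_)
    rcases s with s | s
    · simpa [Φ, cls] using asymMk_eq_iff.2 (hφN s)
    · simpa [Φ, cls] using asymMk_eq_iff.2 (hφN' s)
  rw [← h2, AlgHom.comp_apply, ← map_zero (asymMk d ε), asymMk_eq_iff]
  have h3 : ((Φ r : tameFam d ε) : Fam d) = evalFam φ r := DFunLike.congr_fun h1 r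
  rw [h3]
  simpa using hr.negligible

end Families

/-! ### Rounding to exact projections and measurements -/

section Rounding

variable {Ω : Type*} {d : Ω → ℕ} {ε : Ω → ℝ}

/-- Rounding is done index by index with a universal constant. The annihilation clause is kept so
that projections rounded one after another can be made exactly orthogonal. -/
theorem exists_projection_family_near {x : Fam d} (h1 : SmallFam ε (x * x - x))
    (h2 : SmallFam ε (star x - x)) :
    ∃ Q : bddFam d, star Q = Q ∧ Q * Q = Q ∧ SmallFam ε ((Q : Fam d) - x) ∧
      ∀ R : Fam d, R * x = 0 → R * star x = 0 → R * (Q : Fam d) = 0 := by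
  choose Q hQ1 hQ2 hQ3 hQ4 using fun ω => exists_projection_near (x ω)
  have hQ1' : star Q = Q := funext hQ1
  have hQ2' : Q * Q = Q := funext hQ2
  refine ⟨⟨Q, bddFam_of_projection hQ1' hQ2'⟩, Subtype.ext hQ1', Subtype.ext hQ2', ?_, ?_⟩
  · obtain ⟨C, hC, h1⟩ := h1
    obtain ⟨D, hD, h2⟩ := h2
    refine ⟨4 * (C + D), by positivity, fun ω => (hQ3 ω).trans ?_⟩
    have h3 := h1 ω
    have h4 := h2 ω
    simp only [Pi.sub_apply, Pi.mul_apply, Pi.star_apply, Matrix.star_eq_conjTranspose] at h3 h4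
    linarith
  · exact fun R hR1 hR2 => funext fun ω => hQ4 ω (R ω) (congrFun hR1 ω) (congrFun hR2 ω)

/-- A self-adjoint idempotent class lifts to a projection. -/
theorem exists_projection_cls_eq (hε : ∀ ω, 0 ≤ ε ω) {x : bddFam d}
    (h1 : cls d ε x * cls d ε x = cls d ε x) (h2 : cls d ε (star x) = cls d ε x) :
    ∃ Q : bddFam d, star Q = Q ∧ Q * Q = Q ∧ cls d ε Q = cls d ε x ∧
      ∀ R : bddFam d, R * x = 0 → R * star x = 0 → R * Q = 0 := by
  rw [← map_mul, cls_eq_iff hε] at h1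
  rw [cls_eq_iff hε] at h2
  obtain ⟨Q, hQ1, hQ2, hQ3, hQ4⟩ := exists_projection_family_near h1 h2
  exact ⟨Q, hQ1, hQ2, (cls_eq_iff hε).2 hQ3, fun R hR1 hR2 =>
    Subtype.ext (hQ4 R (congrArg Subtype.val hR1) (congrArg Subtype.val hR2))⟩

/-- Induction on the finite set. With `R` the sum of the projections already built, the next element
is compressed to `(1 - R) * p k * (1 - R)`. Its class is unchanged because `R` and `p k` are
orthogonal in the quotient, and its rounding is exactly orthogonal to `R` because `R` annihilates
the compression and its adjoint. -/
theorem exists_orthogonal_projections_cls_eq {A : Type*} (hε : ∀ ω, 0 ≤ ε ω) {p : A → bddFam d}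
    (h1 : ∀ a, cls d ε (p a) * cls d ε (p a) = cls d ε (p a))
    (h2 : ∀ a, cls d ε (star (p a)) = cls d ε (p a))
    (h3 : ∀ a b, a ≠ b → cls d ε (p a) * cls d ε (p b) = 0) (s : Finset A) :
    ∃ Q : A → bddFam d, ∀ a ∈ s, star (Q a) = Q a ∧ Q a * Q a = Q a ∧
      cls d ε (Q a) = cls d ε (p a) ∧ ∀ b ∈ s, a ≠ b → Q a * Q b = 0 := by
  classical
  induction s using Finset.induction_on with
  | empty => exact ⟨p, by simp⟩
  | insert k s hk ih =>
    obtain ⟨Q, hQ⟩ := ih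
    set R : bddFam d := ∑ a ∈ s, Q a with hR
    have hQR : ∀ a ∈ s, Q a * R = Q a := fun a ha => by
      rw [hR, Finset.mul_sum, Finset.sum_eq_single a]
      · exact (hQ a ha).2.1
      · exact fun b hb hab => (hQ a ha).2.2.2 b hb (Ne.symm hab)
      · exact fun h => absurd ha h
    have hRs : star R = R := by
      rw [hR, star_sum]
      exact Finset.sum_congr rfl fun a ha => (hQ a ha).1
    have hRR : R * R = R := by
      conv_lhs => enter [1]; rw [hR]
      rw [Finset.sum_mul]
      exact Finset.sum_congr rfl hQR
    have hclsR : cls d ε R = ∑ a ∈ s, cls d ε (p a) := by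
      rw [hR, map_sum]
      exact Finset.sum_congr rfl fun a ha => (hQ a ha).2.2.1
    have hne : ∀ a ∈ s, a ≠ k := fun a ha h => hk (h ▸ ha)
    have hRk : cls d ε R * cls d ε (p k) = 0 := by
      rw [hclsR, Finset.sum_mul]
      exact Finset.sum_eq_zero fun a ha => h3 a k (hne a ha)
    have hkR : cls d ε (p k) * cls d ε R = 0 := by
      rw [hclsR, Finset.mul_sum]
      exact Finset.sum_eq_zero fun a ha => h3 k a (hne a ha).symm
    have hx : cls d ε ((1 - R) * p k * (1 - R)) = cls d ε (p k) := by
      rw [map_mul, map_mul, map_sub, map_one, sub_mul, hRk, one_mul, sub_zero, mul_sub, hkR,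
        mul_one, sub_zero]
    have hxs : star ((1 - R) * p k * (1 - R)) = (1 - R) * star (p k) * (1 - R) := by
      rw [star_mul, star_mul, star_sub, star_one, hRs, mul_assoc]
    have hR1 : R * (1 - R) = 0 := by rw [mul_sub, mul_one, hRR, sub_self]
    obtain ⟨P, hP1, hP2, hP3, hP4⟩ := exists_projection_cls_eq hε
      (x := (1 - R) * p k * (1 - R)) (by rw [hx, h1]) (by
        rw [hxs, hx, map_mul, map_mul, h2, ← map_mul, ← map_mul, hx])
    have hRP : R * P = 0 := hP4 R (by rw [← mul_assoc, ← mul_assoc, hR1, zero_mul, zero_mul])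
      (by rw [hxs, ← mul_assoc, ← mul_assoc, hR1, zero_mul, zero_mul])
    have hQP : ∀ a ∈ s, Q a * P = 0 := fun a ha => by
      rw [← hQR a ha, mul_assoc, hRP, mul_zero]
    have hPQ : ∀ a ∈ s, P * Q a = 0 := fun a ha => by
      have := congrArg star (hQP a ha)
      rwa [star_mul, hP1, (hQ a ha).1, star_zero] at this
    refine ⟨Function.update Q k P, fun a ha => ?_⟩
    rcases Finset.mem_insert.1 ha with rfl | ha
    · rw [Function.update_self]
      refine ⟨hP1, hP2, hP3.trans hx, fun b hb hab => ?_⟩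
      rw [Function.update_of_ne hab.symm]
      exact hPQ b ((Finset.mem_insert.1 hb).resolve_left hab.symm)
    · rw [Function.update_of_ne (hne a ha)]
      refine ⟨(hQ a ha).1, (hQ a ha).2.1, (hQ a ha).2.2.1, fun b hb hab => ?_⟩
      rcases Finset.mem_insert.1 hb with hb | hb
      · rw [hb, Function.update_self]; exact hQP a ha
      · rw [Function.update_of_ne (hne b hb)]
        exact (hQ a ha).2.2.2 b hb hab

/-- A projective measurement in the quotient algebra lifts to a projective measurement. -/
theorem exists_measurement_cls_eq {A : Type*} [Fintype A] [Nonempty A] (hε : ∀ ω, 0 ≤ ε ω)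
    {p : A → bddFam d}
    (h1 : ∀ a, cls d ε (p a) * cls d ε (p a) = cls d ε (p a))
    (h2 : ∀ a, cls d ε (star (p a)) = cls d ε (p a))
    (h3 : ∀ a b, a ≠ b → cls d ε (p a) * cls d ε (p b) = 0)
    (h4 : ∑ a, cls d ε (p a) = 1) :
    ∃ Q : A → bddFam d, (∀ a, star (Q a) = Q a) ∧ (∀ a, Q a * Q a = Q a) ∧ ∑ a, Q a = 1 ∧
      ∀ a, cls d ε (Q a) = cls d ε (p a) := by
  classical
  obtain ⟨Q, hQ⟩ := exists_orthogonal_projections_cls_eq hε h1 h2 h3 Finset.univ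
  obtain ⟨a₀⟩ := ‹Nonempty A›
  set R : bddFam d := ∑ a, Q a with hR
  have hQR : Q a₀ * R = Q a₀ := by
    rw [hR, Finset.mul_sum, Finset.sum_eq_single a₀]
    · exact (hQ a₀ (Finset.mem_univ _)).2.1
    · exact fun b hb hab => (hQ a₀ (Finset.mem_univ _)).2.2.2 b hb (Ne.symm hab)
    · exact fun h => absurd (Finset.mem_univ _) h
  have hQa : star (Q a₀) = Q a₀ := (hQ a₀ (Finset.mem_univ _)).1
  have hRs : star R = R := by
    rw [hR, star_sum]
    exact Finset.sum_congr rfl fun a ha => (hQ a ha).1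
  have hRQ : R * Q a₀ = Q a₀ := by
    have := congrArg star hQR
    rwa [star_mul, hRs, hQa] at this
  have hRR : R * R = R := by
    conv_lhs => enter [1]; rw [hR]
    rw [Finset.sum_mul]
    refine Finset.sum_congr rfl fun a ha => ?_
    rw [hR, Finset.mul_sum, Finset.sum_eq_single a]
    · exact (hQ a ha).2.1
    · exact fun b hb hab => (hQ a ha).2.2.2 b hb (Ne.symm hab)
    · exact fun h => absurd ha h
  have hclsR : cls d ε R = 1 := by
    rw [hR, map_sum, ← h4]
    exact Finset.sum_congr rfl fun a ha => (hQ a ha).2.2.1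
  -- The defect `1 - R` is a projection of class `0`, orthogonal to every `Q a`. Assigning it to one
  -- chosen answer makes the sum exactly `1` without changing any class.
  refine ⟨fun a => Q a + if a = a₀ then 1 - R else 0, fun a => ?_, fun a => ?_, ?_, fun a => ?_⟩
  · dsimp only
    split_ifs
    · rw [star_add, star_sub, star_one, hRs, (hQ a (Finset.mem_univ _)).1]
    · rw [add_zero, (hQ a (Finset.mem_univ _)).1]
  · dsimp only
    split_ifs with h
    · subst h
      have hQQ := (hQ a (Finset.mem_univ _)).2.1
      simp [add_mul, mul_add, mul_sub, sub_mul, hRQ, hQR, hRR, hQQ]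
    · rw [add_zero, (hQ a (Finset.mem_univ _)).2.1]
  · rw [Finset.sum_add_distrib, ← hR, Finset.sum_ite_eq']
    simp
  · dsimp only
    rw [map_add, (hQ a (Finset.mem_univ _)).2.2.1]
    split_ifs
    · rw [map_sub, map_one, hclsR, sub_self, add_zero]
    · rw [map_zero, add_zero]

end Rounding

/-! ### The maximally entangled state -/

section MaxEntangled

variable {d : ℕ}

theorem mul_conj_inv_sqrt [NeZero d] :
    ((Real.sqrt d : ℝ) : ℂ)⁻¹ * star ((Real.sqrt d : ℝ) : ℂ)⁻¹ = (d : ℂ)⁻¹ := by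
  rw [star_inv₀, Complex.star_def, Complex.conj_ofReal, ← mul_inv, ← Complex.ofReal_mul,
    Real.mul_self_sqrt (Nat.cast_nonneg d), Complex.ofReal_natCast]

theorem maxEntangled_unit [NeZero d] : star (maxEntangled d) ⬝ᵥ maxEntangled d = 1 := by
  have h : ∀ i j : Fin d, star (maxEntangled d (i, j)) * maxEntangled d (i, j) =
      if i = j then (d : ℂ)⁻¹ else 0 := fun i j => by
    rw [maxEntangled]
    dsimp only
    split_ifs
    · rw [mul_comm, mul_conj_inv_sqrt]
    · simp
  simp only [dotProduct, Pi.star_apply, Fintype.sum_prod_type, h]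
  simp [mul_inv_cancel₀ (NeZero.ne (d : ℂ))]

theorem isMaximallyEntangled_maxEntangled [NeZero d] : IsMaximallyEntangled (maxEntangled d) := by
  refine ⟨maxEntangled_unit, ?_, ?_⟩
  · ext i j
    have h : ∀ t : Fin d, maxEntangled d (i, t) * star (maxEntangled d (j, t)) =
        if i = t then (if j = i then (d : ℂ)⁻¹ else 0) else 0 := fun t => by
      rw [maxEntangled, maxEntangled]
      dsimp only
      by_cases h1 : i = t
      · subst h1
        by_cases h2 : j = i
        · simp only [h2, if_true]; exact mul_conj_inv_sqrt
        · simp [h2]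
      · simp [h1]
    simp only [reducedA, h]
    simp [Matrix.one_apply, eq_comm]
  · ext i j
    have h : ∀ t : Fin d, maxEntangled d (t, i) * star (maxEntangled d (t, j)) =
        if i = t then (if j = i then (d : ℂ)⁻¹ else 0) else 0 := fun t => by
      rw [maxEntangled, maxEntangled]
      dsimp only
      by_cases h1 : i = t
      · subst h1
        by_cases h2 : j = i
        · simp only [h2, if_true]; exact mul_conj_inv_sqrt
        · simp [h2, Ne.symm h2]
      · simp [h1, Ne.symm h1]
    simp only [reducedB, h]
    simp [Matrix.one_apply, eq_comm]

/-- The correlations of the maximally entangled state are given by the normalized trace. -/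
theorem expect_maxEntangled [NeZero d] (P Q : Matrix (Fin d) (Fin d) ℂ) :
    expect (maxEntangled d) (P.map star) Q = (Pᴴ * Q).trace.re / d := by
  have h : star (maxEntangled d) ⬝ᵥ ((P.map star ⊗ₖ Q) *ᵥ maxEntangled d) =
      (d : ℂ)⁻¹ * (Pᴴ * Q).trace := by
    have h1 : ∀ i j : Fin d, ((P.map star ⊗ₖ Q) *ᵥ maxEntangled d) (i, j) =
        ∑ t, star (P i t) * Q j t * ((Real.sqrt d : ℝ) : ℂ)⁻¹ := fun i j => by
      simp [Matrix.mulVec, dotProduct, Fintype.sum_prod_type, maxEntangled]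
    have h2 : ∀ i j : Fin d, star (maxEntangled d (i, j)) *
        ((P.map star ⊗ₖ Q) *ᵥ maxEntangled d) (i, j) =
        if i = j then ∑ t, (d : ℂ)⁻¹ * (star (P i t) * Q i t) else 0 := fun i j => by
      rw [h1, maxEntangled]
      dsimp only
      split_ifs with h
      · subst h
        rw [Finset.mul_sum]
        refine Finset.sum_congr rfl fun t _ => ?_
        rw [← mul_conj_inv_sqrt]
        ring
      · simp
    simp only [dotProduct, Pi.star_apply, Fintype.sum_prod_type, h2]
    simp only [Finset.sum_ite_eq, Finset.mem_univ, if_true, Matrix.trace, Matrix.diag,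
      Matrix.mul_apply, Matrix.conjTranspose_apply, Finset.mul_sum]
    exact Finset.sum_comm
  rw [expect, h, ← Complex.ofReal_natCast, ← Complex.ofReal_inv, Complex.re_ofReal_mul,
    inv_mul_eq_div]

/-- For projections the normalized trace of `P * Q` is a squared norm. This is why products of size
`O(ε)` give probabilities of size `O(ε²)`. -/
theorem expect_maxEntangled_projection [NeZero d] {P Q : Matrix (Fin d) (Fin d) ℂ}
    (hP : Pᴴ = P) (hP' : P * P = P) (hQ : Qᴴ = Q) (hQ' : Q * Q = Q) :
    expect (maxEntangled d) (P.map star) Q = littleFrob (P * Q) ^ 2 := by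
  rw [expect_maxEntangled, littleFrob_sq_eq_trace, Matrix.conjTranspose_mul, hP, hQ,
    Matrix.mul_assoc, ← Matrix.mul_assoc P, hP', Matrix.trace_mul_comm Q, Matrix.mul_assoc, hQ']

end MaxEntangled

/-! ### Winning probabilities -/

section Winning

variable {I J : Type*} [Fintype I] [Fintype J] {A : I → Type*} {B : J → Type*}
  [∀ i, Fintype (A i)] [∀ j, Fintype (B j)]

theorem expect_sum_sum {dA dB : ℕ} {ι κ : Type*} [Fintype ι] [Fintype κ]
    (ψ : Fin dA × Fin dB → ℂ) (P : ι → Matrix (Fin dA) (Fin dA) ℂ)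
    (Q : κ → Matrix (Fin dB) (Fin dB) ℂ) :
    ∑ a, ∑ b, expect ψ (P a) (Q b) = expect ψ (∑ a, P a) (∑ b, Q b) := by
  have h : (∑ a, P a) ⊗ₖ (∑ b, Q b) = ∑ a, ∑ b, P a ⊗ₖ Q b := by
    ext p q
    simp only [Matrix.kroneckerMap_apply, Matrix.sum_apply, Finset.sum_mul_sum]
  simp only [expect, h, Matrix.sum_mulVec, dotProduct_sum, Complex.re_sum]

/-- The losing probability of a strategy. -/
theorem one_sub_winProb {dA dB : ℕ} (G : NonlocalGame I J A B) (S : QStrategy A B dA dB) :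
    1 - G.winProb S = ∑ i, ∑ j, G.η i j *
      ∑ a, ∑ b, if G.V i j a b then 0 else expect S.ψ (S.P i a) (S.Q j b) := by
  have h : ∀ i j, ∑ a, ∑ b, expect S.ψ (S.P i a) (S.Q j b) = 1 := fun i j => by
    rw [expect_sum_sum, S.P_sum, S.Q_sum, expect, Matrix.one_kronecker_one, Matrix.one_mulVec,
      S.ψ_unit, Complex.one_re]
  rw [← G.η_sum, NonlocalGame.winProb, ← Finset.sum_sub_distrib]
  refine Finset.sum_congr rfl fun i _ => ?_
  rw [← Finset.sum_sub_distrib]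
  refine Finset.sum_congr rfl fun j _ => ?_
  nth_rewrite 1 [← mul_one (G.η i j)]
  rw [← h i j, ← mul_sub, ← Finset.sum_sub_distrib]
  congr 1
  refine Finset.sum_congr rfl fun a _ => ?_
  rw [← Finset.sum_sub_distrib]
  refine Finset.sum_congr rfl fun b _ => ?_
  split_ifs <;> simp

/-- The strategy with the maximally entangled state and conjugated measurements for Alice. -/
def conjStrategy {d : ℕ} [NeZero d] (P : ∀ i, A i → Matrix (Fin d) (Fin d) ℂ)
    (Q : ∀ j, B j → Matrix (Fin d) (Fin d) ℂ)
    (P_herm : ∀ i a, (P i a)ᴴ = P i a) (P_idem : ∀ i a, P i a * P i a = P i a)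
    (P_sum : ∀ i, ∑ a, P i a = 1) (Q_herm : ∀ j b, (Q j b)ᴴ = Q j b)
    (Q_idem : ∀ j b, Q j b * Q j b = Q j b) (Q_sum : ∀ j, ∑ b, Q j b = 1) :
    QStrategy A B d d where
  P i a := (P i a).map star
  Q := Q
  P_herm i a := by
    conv_rhs => rw [← P_herm i a]
    ext s t
    simp
  P_idem i a := by
    have h : (P i a * P i a).map (starRingEnd ℂ) = (P i a).map (starRingEnd ℂ) := by
      rw [P_idem]
    rwa [Matrix.map_mul] at h
  P_sum i := by
    have h : (∑ a, P i a).map star = 1 := by rw [P_sum]; ext s t; simp [Matrix.one_apply]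
    rw [← h]
    ext s t
    simp [Matrix.sum_apply]
  Q_herm := Q_herm
  Q_idem := Q_idem
  Q_sum := Q_sum
  ψ := maxEntangled d
  ψ_unit := maxEntangled_unit

/-- If the losing products of projections are `O(ε)`, then the losing probability is `O(ε²)`. -/
theorem conjStrategy_isPerfectUpTo (G : NonlocalGame I J A B) {d : ℕ} [NeZero d] {C ε : ℝ}
    {P : ∀ i, A i → Matrix (Fin d) (Fin d) ℂ} {Q : ∀ j, B j → Matrix (Fin d) (Fin d) ℂ}
    (P_herm : ∀ i a, (P i a)ᴴ = P i a) (P_idem : ∀ i a, P i a * P i a = P i a)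
    (P_sum : ∀ i, ∑ a, P i a = 1) (Q_herm : ∀ j b, (Q j b)ᴴ = Q j b)
    (Q_idem : ∀ j b, Q j b * Q j b = Q j b) (Q_sum : ∀ j, ∑ b, Q j b = 1)
    (hPQ : ∀ i j a b, G.V i j a b = false → littleFrob (P i a * Q j b) ≤ C * ε) :
    G.IsPerfectUpTo
      ((∑ i, ∑ j, G.η i j * (Fintype.card (A i) * (Fintype.card (B j) * C ^ 2))) * ε ^ 2)
      (conjStrategy P Q P_herm P_idem P_sum Q_herm Q_idem Q_sum) := by
  rw [NonlocalGame.IsPerfectUpTo, sub_le_comm, one_sub_winProb, Finset.sum_mul]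
  refine Finset.sum_le_sum fun i _ => ?_
  rw [Finset.sum_mul]
  refine Finset.sum_le_sum fun j _ => ?_
  rw [mul_assoc]
  refine mul_le_mul_of_nonneg_left ?_ (G.η_nonneg i j)
  have h : ∀ a b, (if G.V i j a b then 0 else
      expect (maxEntangled d) ((P i a).map star) (Q j b)) ≤ C ^ 2 * ε ^ 2 := fun a b => by
    split_ifs with hV
    · positivity
    · rw [expect_maxEntangled_projection (P_herm i a) (P_idem i a) (Q_herm j b) (Q_idem j b),
        ← mul_pow]
      exact pow_le_pow_left₀ (littleFrob_nonneg _) (hPQ i j a b (by simpa using hV)) 2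
  calc _ ≤ ∑ a : A i, ∑ b : B j, C ^ 2 * ε ^ 2 :=
        Finset.sum_le_sum fun a _ => Finset.sum_le_sum fun b _ => h a b
    _ = _ := by simp; ring

end Winning

/-! ### The family of all approximate representations -/

/-- The approximate representations of a presentation, of all dimensions and qualities. -/
structure ApproxRep {S : Type*} (𝒜 : StarPresentation S) where
  d : ℕ
  neZero : NeZero d
  ε : ℝ
  ε_nonneg : 0 ≤ ε
  φ : S → Matrix (Fin d) (Fin d) ℂ
  isApproxRep : 𝒜.IsApproxRep ε φ

namespace ApproxRep

variable {S : Type*} {𝒜 : StarPresentation S}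

instance (ω : ApproxRep 𝒜) : NeZero ω.d := ω.neZero

variable (𝒜) in
/-- The value of a generator at all approximate representations. -/
def fam (s : S) : Fam (ApproxRep.d (𝒜 := 𝒜)) := fun ω => ω.φ s

/-- With each representation carrying its own `ε`, the hypothesis of the theorem is smallness with
constant `1`; any constant found for the family is therefore uniform. -/
theorem smallFam_evalFam {r : FreeStar S} (hr : r ∈ 𝒜.rel) :
    SmallFam (ApproxRep.ε (𝒜 := 𝒜)) (evalFam (fam 𝒜) r) :=
  ⟨1, zero_le_one, fun ω => by
    rw [evalFam_apply, one_mul]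
    exact ω.isApproxRep r hr⟩

end ApproxRep

section Eval

variable {Ω : Type*} {d : Ω → ℕ} {S : Type*} (φ : S → Fam d) (s : S)

@[simp]
theorem evalFam_gen : evalFam φ (gen s) = φ s := by simp [evalFam, gen]

@[simp]
theorem evalFam_genStar : evalFam φ (genStar s) = star (φ s) := by simp [evalFam, genStar]

variable {R : Type*} [Ring R] [Algebra ℂ R] (x : S → R)

@[simp]
theorem lift_gen : FreeAlgebra.lift ℂ (Sum.elim x x) (gen s) = x s := by simp [gen]

end Eval

/-! ### Synchronous games -/

/-- Rounding each generator separately gives projections that add up to `1` and multiply to zero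
only in the quotient. Synchronicity supplies the orthogonality of distinct answers to one question,
so each question gives a measurement in the quotient, which lifts. Losing products have class zero,
and being bounded they are small. -/
theorem SynchronousGame.exists_measurement_families {I A : Type*} [Fintype I] [Fintype A]
    [Nonempty A] (G : SynchronousGame I A) {Ω : Type*} {d : Ω → ℕ} {ε : Ω → ℝ} (hε : ∀ ω, 0 ≤ ε ω)
    (φ : I × A → Fam d) (hφ : ∀ r ∈ G.algebra.rel, SmallFam ε (evalFam φ r)) :
    ∃ Q : I → A → bddFam d, (∀ i a, star (Q i a) = Q i a) ∧ (∀ i a, Q i a * Q i a = Q i a) ∧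
      (∀ i, ∑ a, Q i a = 1) ∧ (∀ i a, SmallFam ε ((Q i a : Fam d) - φ (i, a))) ∧
      ∀ i j a b, G.V i j a b = false → SmallFam ε ((Q i a : Fam d) * (Q j b : Fam d)) := by
  have hidem : ∀ s, SmallFam ε (φ s * φ s - φ s) := fun s => by
    simpa using hφ (gen s * gen s - gen s) (Or.inl (Or.inl (Or.inl ⟨s, rfl⟩)))
  have hstar : ∀ s, SmallFam ε (star (φ s) - φ s) := fun s => by
    simpa using hφ (genStar s - gen s) (Or.inl (Or.inl (Or.inr ⟨s, rfl⟩)))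
  choose X hX1 hX2 hX3 _ using fun s => exists_projection_family_near (hidem s) (hstar s)
  have hsum : ∀ i, ∑ a, cls d ε (X (i, a)) = 1 := fun i => by
    have h := lift_cls_eq_zero hX1 hX3
      (hφ ((∑ a : A, gen (i, a)) - 1) (Or.inl (Or.inr ⟨i, rfl⟩)))
    simpa [sub_eq_zero] using h
  have hmul : ∀ i j a b, G.V i j a b = false → cls d ε (X (i, a)) * cls d ε (X (j, b)) = 0 :=
    fun i j a b hV => by
      have h := lift_cls_eq_zero hX1 hX3
        (hφ (gen (i, a) * gen (j, b)) (Or.inr ⟨((i, a), (j, b)), hV, rfl⟩))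
      simpa using h
  choose Q hQ1 hQ2 hQ3 hQ4 using fun i => exists_measurement_cls_eq hε (p := fun a => X (i, a))
    (fun a => by rw [← map_mul, hX2]) (fun a => by rw [hX1])
    (fun a b hab => hmul i i a b (G.sync i a b hab)) (hsum i)
  refine ⟨Q, hQ1, hQ2, hQ3, fun i a => ?_, fun i j a b hV => ?_⟩
  · simpa using ((cls_eq_iff hε).1 (hQ4 i a)).add (hX3 (i, a))
  · refine (cls_eq_zero_iff hε (x := Q i a * Q j b)).1 ?_
    rw [map_mul, hQ4, hQ4]
    exact hmul _ _ _ _ hV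

/-- Both players use the same lifted projections, conjugated for Alice, evaluated at the index `ω`
of the given representation. -/
theorem SynchronousGame.exists_approx_strategy {I A : Type*} [Fintype I] [Fintype A] [Nonempty A]
    (G : SynchronousGame I A) :
    ∃ C : ℝ, ∀ (d : ℕ) [NeZero d] (ε : ℝ) (φ : I × A → Matrix (Fin d) (Fin d) ℂ), 0 ≤ ε →
      G.algebra.IsApproxRep ε φ →
      ∃ S : QStrategy (fun _ : I => A) (fun _ : I => A) d d,
        S.ψ = maxEntangled d ∧ IsMaximallyEntangled S.ψ ∧ IsSynchronous S ∧
        G.IsPerfectUpTo (C * ε ^ 2) S ∧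
        (∀ i a, littleFrob (S.Q i a - φ (i, a)) ≤ C * ε) ∧
        (∀ i a, littleFrob (S.P i a - (φ (i, a)).map star) ≤ C * ε) := by
  obtain ⟨Q, hQ1, hQ2, hQ3, hQφ, hQQ⟩ := G.exists_measurement_families
    (fun ω : ApproxRep G.algebra => ω.ε_nonneg) (ApproxRep.fam G.algebra)
    (fun r hr => ApproxRep.smallFam_evalFam hr)
  obtain ⟨C₁, hC₁, h₁⟩ := exists_uniform_of_smallFam
    (fun ω : ApproxRep G.algebra => ω.ε_nonneg) (fun s : I × A => hQφ s.1 s.2)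
  obtain ⟨C₂, hC₂, h₂⟩ := exists_uniform_of_smallFam
    (fun ω : ApproxRep G.algebra => ω.ε_nonneg)
    (fun q : {q : (I × A) × (I × A) // G.V q.1.1 q.2.1 q.1.2 q.2.2 = false} =>
      hQQ q.1.1.1 q.1.2.1 q.1.1.2 q.1.2.2 q.2)
  -- Each losing pair of answers contributes at most `C₂ ^ 2 * ε ^ 2`; `K` bounds the number of
  -- pairs by the square of the number of answers and averages over questions.
  set K := ∑ i : I, ∑ j : I, G.η i j *
    ((Fintype.card A : ℝ) * ((Fintype.card A : ℝ) * C₂ ^ 2)) with hK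
  refine ⟨max C₁ K, fun d _ ε φ hε0 hφ => ?_⟩
  let ω : ApproxRep G.algebra := ⟨d, inferInstance, ε, hε0, φ, hφ⟩
  have e1 : ∀ i a, ((Q i a).1 ω)ᴴ = (Q i a).1 ω := fun i a =>
    congrFun (congrArg Subtype.val (hQ1 i a)) ω
  have e2 : ∀ i a, (Q i a).1 ω * (Q i a).1 ω = (Q i a).1 ω := fun i a =>
    congrFun (congrArg Subtype.val (hQ2 i a)) ω
  have e3 : ∀ i, ∑ a, (Q i a).1 ω = 1 := fun i => by
    have h := congrFun (congrArg Subtype.val (hQ3 i)) ω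
    simpa using h
  have e4 : ∀ i a, littleFrob ((Q i a).1 ω - φ (i, a)) ≤ max C₁ K * ε := fun i a =>
    (h₁ (i, a) ω).trans (mul_le_mul_of_nonneg_right (le_max_left _ _) hε0)
  refine ⟨conjStrategy (A := fun _ : I => A) (B := fun _ : I => A)
    (fun i a => (Q i a).1 ω) (fun i a => (Q i a).1 ω)
    e1 e2 e3 e1 e2 e3, rfl, isMaximallyEntangled_maxEntangled, fun _ _ => rfl, ?_, e4, ?_⟩
  · have h := conjStrategy_isPerfectUpTo G.toNonlocalGame (C := C₂) (ε := ε) e1 e2 e3 e1 e2 e3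
      (fun i j a b hV => h₂ ⟨((i, a), (j, b)), hV⟩ ω)
    refine le_trans ?_ h
    rw [← hK]
    gcongr
    exact le_max_right _ _
  · intro i a
    exact (littleFrob_map_star_sub ((Q i a).1 ω) (φ (i, a))).trans_le (e4 i a)

/-! ### Joint spectral projections of commuting involutions -/

section JointSpectral

/-- The spectral element `(1 + (-1)^b x) / 2` of an involution. -/
def spec {R : Type*} [Ring R] [Algebra ℂ R] (x : R) (b : Bool) : R := (2⁻¹ : ℂ) • (1 + sgn b • x)

/-- The ordered product of the spectral elements of a tuple of involutions. -/
def jointSpec {R : Type*} [Ring R] [Algebra ℂ R] {k : ℕ} (x : Fin k → R) (α : Fin k → Bool) : R :=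
  (List.ofFn fun l => spec (x l) (α l)).prod

variable {R T : Type*} [Ring R] [Algebra ℂ R] [Ring T] [Algebra ℂ T] {k : ℕ}

theorem map_spec (f : R →ₐ[ℂ] T) (x : R) (b : Bool) : f (spec x b) = spec (f x) b := by
  simp [spec]

theorem map_jointSpec (f : R →ₐ[ℂ] T) (x : Fin k → R) (α : Fin k → Bool) :
    f (jointSpec x α) = jointSpec (fun l => f (x l)) α := by
  rw [jointSpec, jointSpec, map_list_prod, List.map_ofFn]
  simp only [Function.comp_def, map_spec]

theorem sgn_mul_self (b : Bool) : sgn b * sgn b = 1 := by cases b <;> simp [sgn]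

theorem star_sgn (b : Bool) : star (sgn b) = sgn b := by cases b <;> simp [sgn]

theorem spec_false_add_true (x : R) : spec x false + spec x true = 1 := by
  rw [spec, spec, ← smul_add, sgn, sgn]
  simp only [if_true, Bool.false_eq_true, if_false, one_smul, neg_smul]
  rw [add_add_add_comm, add_neg_cancel, add_zero, ← two_smul ℂ (1 : R), smul_smul]
  norm_num

theorem sum_sgn_smul_spec (x : R) : ∑ b, sgn b • spec x b = x := by
  rw [Fintype.sum_bool, spec, spec, sgn, sgn]
  simp only [if_true, Bool.false_eq_true, if_false, one_smul, neg_smul, smul_add, smul_neg]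
  rw [neg_neg]
  have h : (2⁻¹ : ℂ) • x + (2⁻¹ : ℂ) • x = x := by
    rw [← add_smul]; norm_num
  nth_rewrite 3 [← h]
  abel

theorem spec_mul_self {x : R} (hx : x * x = 1) (b : Bool) : spec x b * x = sgn b • spec x b := by
  rw [spec, smul_mul_assoc, add_mul, one_mul, smul_mul_assoc, hx, smul_comm (sgn b)]
  congr 1
  rw [smul_add, smul_smul, sgn_mul_self, one_smul, add_comm]

theorem spec_mul_spec {x : R} (hx : x * x = 1) (b c : Bool) :
    spec x b * spec x c = if b = c then spec x b else 0 := by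
  conv_lhs => enter [2]; rw [spec]
  rw [mul_smul_comm, mul_add, mul_one, mul_smul_comm, spec_mul_self hx, smul_smul]
  have h : sgn c * sgn b = if b = c then 1 else -1 := by
    cases b <;> cases c <;> simp [sgn]
  rw [h]
  split_ifs
  · rw [one_smul, ← two_smul ℂ, smul_smul]; norm_num
  · simp

/-! ### Joint spectral elements in a commutative algebra. -/

section Comm

variable {R : Type*} [CommRing R] [Algebra ℂ R] {k : ℕ} {x : Fin k → R}

theorem jointSpec_eq_prod (x : Fin k → R) (α : Fin k → Bool) :
    jointSpec x α = ∏ l, spec (x l) (α l) := by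
  rw [jointSpec, List.prod_ofFn]

theorem jointSpec_mul_spec_of_comm (hx : ∀ l, x l * x l = 1) (α : Fin k → Bool) (l : Fin k)
    (b : Bool) : jointSpec x α * spec (x l) b = if α l = b then jointSpec x α else 0 := by
  rw [jointSpec_eq_prod, ← Finset.mul_prod_erase _ _ (Finset.mem_univ l), mul_right_comm,
    spec_mul_spec (hx l)]
  split_ifs <;> simp

theorem jointSpec_mul_of_comm (hx : ∀ l, x l * x l = 1) (α : Fin k → Bool) (l : Fin k) :
    jointSpec x α * x l = sgn (α l) • jointSpec x α := by
  rw [jointSpec_eq_prod, ← Finset.mul_prod_erase _ _ (Finset.mem_univ l), mul_right_comm,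
    spec_mul_self (hx l), smul_mul_assoc]

theorem jointSpec_mul_jointSpec_of_comm (hx : ∀ l, x l * x l = 1) (α β : Fin k → Bool) :
    jointSpec x α * jointSpec x β = if α = β then jointSpec x α else 0 := by
  rw [jointSpec_eq_prod, jointSpec_eq_prod, ← Finset.prod_mul_distrib]
  simp only [spec_mul_spec (hx _)]
  split_ifs with h
  · subst h; simp
  · obtain ⟨l, hl⟩ := Function.ne_iff.1 h
    exact Finset.prod_eq_zero (Finset.mem_univ l) (by simp [hl])

theorem sum_jointSpec_of_comm (x : Fin k → R) : ∑ α, jointSpec x α = 1 := by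
  simp only [jointSpec_eq_prod]
  rw [← Fintype.prod_sum (fun l b => spec (x l) b)]
  refine Finset.prod_eq_one fun l _ => ?_
  rw [Fintype.sum_bool, add_comm, spec_false_add_true]

theorem jointSpec_reverse_of_comm (x : Fin k → R) (α : Fin k → Bool) :
    (List.ofFn fun l => spec (x l) (α l)).reverse.prod = jointSpec x α :=
  (List.reverse_perm _).prod_eq

end Comm

universe u in
/-- A commuting tuple comes from a commutative algebra. -/
theorem exists_comm_algebra_of_commute {R : Type u} [Ring R] [Algebra ℂ R] {k : ℕ} (x : Fin k → R)
    (hx : ∀ l l', x l * x l' = x l' * x l) :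
    ∃ (T : Type u) (_ : CommRing T) (_ : Algebra ℂ T) (f : T →ₐ[ℂ] R) (y : Fin k → T),
      Function.Injective f ∧ x = fun l => f (y l) := by
  have hcomm : ∀ a ∈ Set.range x, ∀ b ∈ Set.range x, a * b = b * a := by
    rintro _ ⟨l, rfl⟩ _ ⟨l', rfl⟩
    exact hx l l'
  have := Algebra.isMulCommutative_adjoin ℂ hcomm
  let _ : CommRing (Algebra.adjoin ℂ (Set.range x)) :=
    { (inferInstance : Ring (Algebra.adjoin ℂ (Set.range x))) with
      mul_comm := mul_comm' }
  exact ⟨Algebra.adjoin ℂ (Set.range x), inferInstance, inferInstance,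
    (Algebra.adjoin ℂ (Set.range x)).val, fun l => ⟨x l, Algebra.subset_adjoin ⟨l, rfl⟩⟩,
    Subtype.val_injective, rfl⟩

variable {x : Fin k → R}

/-- The joint spectral elements of commuting involutions form a resolution of the identity. -/
theorem jointSpec_properties (hx : ∀ l, x l * x l = 1) (hc : ∀ l l', x l * x l' = x l' * x l) :
    (∀ α l b, jointSpec x α * spec (x l) b = if α l = b then jointSpec x α else 0) ∧
    (∀ α β, jointSpec x α * jointSpec x β = if α = β then jointSpec x α else 0) ∧
    ∑ α, jointSpec x α = 1 ∧
    (∀ l, ∑ α, sgn (α l) • jointSpec x α = x l) ∧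
    (∀ α, (List.ofFn fun l => spec (x l) (α l)).reverse.prod = jointSpec x α) := by
  -- All identities are proved in a commutative algebra, where the ordered product is a finite
  -- product, and pushed forward along the injective map `f`.
  obtain ⟨T, _, _, f, y, hf, rfl⟩ := exists_comm_algebra_of_commute x hc
  have hy : ∀ l, y l * y l = 1 := fun l => hf (by rw [map_mul, map_one, hx])
  refine ⟨fun α l b => ?_, fun α β => ?_, ?_, fun l => ?_, fun α => ?_⟩
  · rw [← map_jointSpec, ← map_spec, ← map_mul, jointSpec_mul_spec_of_comm hy]
    split_ifs <;> simp
  · rw [← map_jointSpec, ← map_jointSpec, ← map_mul, jointSpec_mul_jointSpec_of_comm hy]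
    split_ifs <;> simp
  · simp only [← map_jointSpec]
    rw [← map_sum, sum_jointSpec_of_comm, map_one]
  · simp only [← map_jointSpec, ← map_smul, ← jointSpec_mul_of_comm hy]
    rw [← map_sum, ← Finset.sum_mul, sum_jointSpec_of_comm, one_mul]
  · rw [← map_jointSpec, ← jointSpec_reverse_of_comm, map_list_prod, List.map_reverse,
      List.map_ofFn]
    simp only [Function.comp_def, map_spec]

end JointSpectral

/-! ### Binary constraint system games -/

section BCS

variable {Ω : Type*} {d : Ω → ℕ} {ε : Ω → ℝ}

/-- The substitution `x ↦ (1 + x) / 2` exchanges involutions and idempotents, scaling the defect `x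
* x - 1` by `1 / 4`. Round there and return by `Q ↦ 2 Q - 1`. -/
theorem exists_involution_family_near {x : Fam d} (h1 : SmallFam ε (x * x - 1))
    (h2 : SmallFam ε (star x - x)) :
    ∃ X : bddFam d, star X = X ∧ X * X = 1 ∧ SmallFam ε ((X : Fam d) - x) := by
  have h3 : SmallFam ε ((2⁻¹ : ℂ) • (1 + x) * (2⁻¹ : ℂ) • (1 + x) - (2⁻¹ : ℂ) • (1 + x)) := by
    have h : (2⁻¹ : ℂ) • (1 + x) * (2⁻¹ : ℂ) • (1 + x) - (2⁻¹ : ℂ) • (1 + x) =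
        (4⁻¹ : ℂ) • (x * x - 1) := by
      rw [smul_mul_smul_comm]
      simp only [mul_add, add_mul, mul_one, one_mul]
      module
    rw [h]
    exact h1.smul _
  have h4 : SmallFam ε (star ((2⁻¹ : ℂ) • (1 + x)) - (2⁻¹ : ℂ) • (1 + x)) := by
    have h : star ((2⁻¹ : ℂ) • (1 + x)) - (2⁻¹ : ℂ) • (1 + x) = (2⁻¹ : ℂ) • (star x - x) := by
      rw [star_smul, star_add, star_one]
      simp only [star_inv₀, star_ofNat]
      module
    rw [h]
    exact h2.smul _
  obtain ⟨Q, hQ1, hQ2, hQ3, -⟩ := exists_projection_family_near h3 h4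
  refine ⟨(2 : ℂ) • Q - 1, ?_, ?_, ?_⟩
  · rw [star_sub, star_smul, hQ1, star_one]
    simp
  · rw [sub_mul, mul_sub, smul_mul_smul_comm, hQ2, mul_one, one_mul]
    module
  · have h : (((2 : ℂ) • Q - 1 : bddFam d) : Fam d) - x =
        (2 : ℂ) • ((Q : Fam d) - (2⁻¹ : ℂ) • (1 + x)) := by
      push_cast
      module
    rw [h]
    exact hQ3.smul _

theorem star_spec {X : bddFam d} (hX : star X = X) (b : Bool) : star (spec X b) = spec X b := by
  rw [spec, star_smul, star_add, star_smul, star_one, hX, star_sgn]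
  simp

/-- The adjoint reverses the order of the factors. The rounded involutions do not commute exactly,
so self-adjointness holds only for the class, by the reversal clause of `jointSpec_properties`. -/
theorem star_jointSpec {k : ℕ} {X : Fin k → bddFam d} (hX : ∀ l, star (X l) = X l)
    (α : Fin k → Bool) :
    star (jointSpec X α) = (List.ofFn fun l => spec (X l) (α l)).reverse.prod := by
  have h : ∀ L : List (bddFam d), (∀ y ∈ L, star y = y) → star L.prod = L.reverse.prod := by
    intro L
    induction L with
    | nil => simp
    | cons y L ih =>
      intro hL
      rw [List.prod_cons, star_mul, ih fun z hz => hL z (List.mem_cons_of_mem _ hz),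
        hL y List.mem_cons_self]
      simp
  refine h _ fun y hy => ?_
  obtain ⟨l, rfl⟩ := (List.mem_ofFn' _ _).1 hy
  exact star_spec (hX l) _

/-- Bob's measurements are the exact spectral projections of the rounded involutions `X j`. For
Alice, the involutions of one scope commute in the quotient, so their joint spectral elements form a
measurement there, which lifts. Losing products vanish in the quotient either because the assignment
violates the constraint or because the two values of a shared variable differ. -/
theorem BCSGame.exists_measurement_families {m n : ℕ} (G : BCSGame m n) (hε : ∀ ω, 0 ≤ ε ω)
    (φ : Fin n → Fam d) (hφ : ∀ r ∈ G.algebra.rel, SmallFam ε (evalFam φ r)) :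
    ∃ (P : ∀ i, G.Assign i → bddFam d) (Q : Fin n → Bool → bddFam d),
      (∀ i α, star (P i α) = P i α) ∧ (∀ i α, P i α * P i α = P i α) ∧
      (∀ i, ∑ α, P i α = 1) ∧
      (∀ j b, star (Q j b) = Q j b) ∧ (∀ j b, Q j b * Q j b = Q j b) ∧
      (∀ j, ∑ b, Q j b = 1) ∧
      (∀ j, SmallFam ε (((∑ b, sgn b • Q j b : bddFam d) : Fam d) - φ j)) ∧
      (∀ i l, SmallFam ε
        (((∑ α, sgn (α l) • P i α : bddFam d) : Fam d) - φ (G.scope i l))) ∧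
      ∀ i j α b, G.toNonlocalGame.V i j α b = false →
        SmallFam ε ((P i α : Fam d) * (Q j b : Fam d)) := by
  have hsq : ∀ j, SmallFam ε (φ j * φ j - 1) := fun j => by
    simpa using hφ (gen j * gen j - 1) (Or.inl (Or.inl (Or.inr ⟨j, rfl⟩)))
  have hstar : ∀ j, SmallFam ε (star (φ j) - φ j) := fun j => by
    simpa using hφ (genStar j - gen j) (Or.inl (Or.inl (Or.inl ⟨j, rfl⟩)))
  choose X hX1 hX2 hX3 using fun j => exists_involution_family_near (hsq j) (hstar j)
  have hx : ∀ j, cls d ε (X j) * cls d ε (X j) = 1 := fun j => by rw [← map_mul, hX2, map_one]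
  have hc : ∀ i l l', cls d ε (X (G.scope i l)) * cls d ε (X (G.scope i l')) =
      cls d ε (X (G.scope i l')) * cls d ε (X (G.scope i l)) := fun i l l' => by
    have h := lift_cls_eq_zero hX1 hX3 (hφ (gen (G.scope i l) * gen (G.scope i l') -
      gen (G.scope i l') * gen (G.scope i l)) (Or.inr ⟨⟨i, l, l'⟩, rfl⟩))
    simpa [sub_eq_zero] using h
  have hpoly : ∀ i, ∑ α : G.Assign i, sgn (G.constraint i α) •
      jointSpec (fun l => cls d ε (X (G.scope i l))) α = -1 := fun i => by
    have h := lift_cls_eq_zero hX1 hX3 (hφ (G.poly i + 1) (Or.inl (Or.inr ⟨i, rfl⟩)))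
    have h' : G.poly i = ∑ α : G.Assign i, sgn (G.constraint i α) •
      jointSpec (fun l => gen (G.scope i l)) α := rfl
    rw [h', map_add, map_one, map_sum] at h
    simp only [map_smul, map_jointSpec, lift_gen] at h
    exact eq_neg_of_add_eq_zero_left h
  have hJ := fun i => jointSpec_properties (fun l => hx (G.scope i l)) (hc i)
  have hbad : ∀ i (β : G.Assign i), G.constraint i β = false →
      jointSpec (fun l => cls d ε (X (G.scope i l))) β = 0 := fun i β hβ => by
    -- Multiplying `f_i = -1` by the spectral element of a violating `β` leaves that element, with
    -- sign `+1`, equal to its own negative.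
    have h := congrArg (fun z => z * jointSpec (fun l => cls d ε (X (G.scope i l))) β) (hpoly i)
    simp only [Finset.sum_mul, smul_mul_assoc, (hJ i).2.1, smul_ite, smul_zero] at h
    rw [Finset.sum_ite_eq' Finset.univ β] at h
    simp only [Finset.mem_univ, if_true, hβ, sgn, Bool.false_eq_true, if_false, one_smul,
      neg_mul, one_mul] at h
    have h2 : (2 : ℂ) • jointSpec (fun l => cls d ε (X (G.scope i l))) β = 0 := by
      rw [two_smul]
      nth_rewrite 1 [h]
      rw [neg_add_cancel]
    exact (smul_eq_zero_iff_right two_ne_zero).1 h2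
  choose P hP1 hP2 hP3 hP4 using fun i => exists_measurement_cls_eq hε
    (p := fun α : G.Assign i => jointSpec (fun l => X (G.scope i l)) α)
    (fun α => by rw [map_jointSpec, (hJ i).2.1, if_pos rfl])
    (fun α => by
      rw [star_jointSpec (fun l => hX1 _), map_jointSpec, ← (hJ i).2.2.2.2 α, map_list_prod,
        List.map_reverse, List.map_ofFn]
      simp only [Function.comp_def, map_spec])
    (fun α β hαβ => by rw [map_jointSpec, map_jointSpec, (hJ i).2.1, if_neg hαβ])
    (by simp only [map_jointSpec]; exact (hJ i).2.2.1)
  simp only [map_jointSpec] at hP4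
  refine ⟨P, fun j b => spec (X j) b, hP1, hP2, hP3, fun j b => star_spec (hX1 j) b,
    fun j b => by rw [spec_mul_spec (hX2 j), if_pos rfl],
    fun j => by rw [Fintype.sum_bool, add_comm, spec_false_add_true],
    fun j => by rw [sum_sgn_smul_spec]; exact hX3 j, fun i l => ?_, fun i j α b hV => ?_⟩
  · have h : cls d ε (∑ α, sgn (α l) • P i α) = cls d ε (X (G.scope i l)) := by
      rw [map_sum, ← (hJ i).2.2.2.1 l]
      simp only [map_smul, hP4]
    simpa using ((cls_eq_iff hε).1 h).add (hX3 (G.scope i l))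
  · refine (cls_eq_zero_iff hε (x := P i α * spec (X j) b)).1 ?_
    rw [map_mul, map_spec, hP4]
    simp only [BCSGame.toNonlocalGame, Bool.and_eq_false_iff, decide_eq_false_iff_not,
      not_forall] at hV
    rcases hV with hV | ⟨l, rfl, hl⟩
    · rw [hbad i α hV, zero_mul]
    · rw [(hJ i).1, if_neg hl]

/-- Evaluation of the uniform families at one representation. Since the signs `sgn` are real,
conjugating Alice's projections conjugates her observables. -/
theorem BCSGame.exists_approx_strategy {m n : ℕ} (G : BCSGame m n) :
    ∃ C : ℝ, ∀ (d : ℕ) [NeZero d] (ε : ℝ) (φ : Fin n → Matrix (Fin d) (Fin d) ℂ), 0 ≤ ε →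
      G.algebra.IsApproxRep ε φ →
      ∃ S : QStrategy G.Assign (fun _ : Fin n => Bool) d d,
        S.ψ = maxEntangled d ∧ IsMaximallyEntangled S.ψ ∧
        G.toNonlocalGame.IsPerfectUpTo (C * ε ^ 2) S ∧
        (∀ j, littleFrob (BCSGame.obsB S j - φ j) ≤ C * ε) ∧
        (∀ i l, littleFrob (BCSGame.obsA S i l - (φ (G.scope i l)).map star) ≤ C * ε) := by
  obtain ⟨P, Q, hP1, hP2, hP3, hQ1, hQ2, hQ3, hQφ, hPφ, hPQ⟩ := G.exists_measurement_families
    (fun ω : ApproxRep G.algebra => ω.ε_nonneg) (ApproxRep.fam G.algebra)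
    (fun r hr => ApproxRep.smallFam_evalFam hr)
  obtain ⟨C₁, hC₁, h₁⟩ := exists_uniform_of_smallFam
    (fun ω : ApproxRep G.algebra => ω.ε_nonneg) hQφ
  obtain ⟨C₂, hC₂, h₂⟩ := exists_uniform_of_smallFam
    (fun ω : ApproxRep G.algebra => ω.ε_nonneg)
    (fun q : Σ i : Fin m, Fin (G.arity i) => hPφ q.1 q.2)
  obtain ⟨C₃, hC₃, h₃⟩ := exists_uniform_of_smallFam
    (fun ω : ApproxRep G.algebra => ω.ε_nonneg)
    (fun q : {q : (Σ i : Fin m, G.Assign i) × (Fin n × Bool) //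
        G.toNonlocalGame.V q.1.1 q.2.1 q.1.2 q.2.2 = false} =>
      hPQ q.1.1.1 q.1.2.1 q.1.1.2 q.1.2.2 q.2)
  set K := ∑ i, ∑ j, G.toNonlocalGame.η i j *
    ((Fintype.card (G.Assign i) : ℝ) * ((Fintype.card Bool : ℝ) * C₃ ^ 2)) with hK
  refine ⟨max K (max C₁ C₂), fun d _ ε φ hε0 hφ => ?_⟩
  let ω : ApproxRep G.algebra := ⟨d, inferInstance, ε, hε0, φ, hφ⟩
  have e1 : ∀ i a, ((P i a).1 ω)ᴴ = (P i a).1 ω := fun i a =>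
    congrFun (congrArg Subtype.val (hP1 i a)) ω
  have e2 : ∀ i a, (P i a).1 ω * (P i a).1 ω = (P i a).1 ω := fun i a =>
    congrFun (congrArg Subtype.val (hP2 i a)) ω
  have e3 : ∀ i, ∑ a, (P i a).1 ω = 1 := fun i => by
    have h := congrFun (congrArg Subtype.val (hP3 i)) ω
    simpa using h
  have f1 : ∀ j b, ((Q j b).1 ω)ᴴ = (Q j b).1 ω := fun j b =>
    congrFun (congrArg Subtype.val (hQ1 j b)) ω
  have f2 : ∀ j b, (Q j b).1 ω * (Q j b).1 ω = (Q j b).1 ω := fun j b =>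
    congrFun (congrArg Subtype.val (hQ2 j b)) ω
  have f3 : ∀ j, ∑ b, (Q j b).1 ω = 1 := fun j => by
    have h := congrFun (congrArg Subtype.val (hQ3 j)) ω
    simpa only [AddSubmonoidClass.coe_finsetSum, Finset.sum_apply, OneMemClass.coe_one,
      Pi.one_apply] using h
  refine ⟨conjStrategy (A := G.Assign) (B := fun _ : Fin n => Bool)
    (fun i a => (P i a).1 ω) (fun j b => (Q j b).1 ω)
    e1 e2 e3 f1 f2 f3, rfl, isMaximallyEntangled_maxEntangled, ?_, fun j => ?_, fun i l => ?_⟩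
  · have h := conjStrategy_isPerfectUpTo G.toNonlocalGame (C := C₃) (ε := ε) e1 e2 e3 f1 f2 f3
      (fun i j a b hV => h₃ ⟨(⟨i, a⟩, (j, b)), hV⟩ ω)
    refine le_trans ?_ h
    rw [← hK]
    gcongr
    exact le_max_left _ _
  · have h : BCSGame.obsB (conjStrategy (A := G.Assign) (B := fun _ : Fin n => Bool)
        (fun i a => (P i a).1 ω) (fun j b => (Q j b).1 ω) e1 e2 e3 f1 f2 f3) j =
        (∑ b, sgn b • Q j b : bddFam _).1 ω := by
      simp [BCSGame.obsB, conjStrategy]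
    rw [h]
    exact (h₁ j ω).trans (mul_le_mul_of_nonneg_right
      ((le_max_left _ _).trans (le_max_right _ _)) hε0)
  · have h : BCSGame.obsA (conjStrategy (A := G.Assign) (B := fun _ : Fin n => Bool)
        (fun i a => (P i a).1 ω) (fun j b => (Q j b).1 ω) e1 e2 e3 f1 f2 f3) i l =
        ((∑ α, sgn (α l) • P i α : bddFam _).1 ω).map star := by
      ext s t
      simp only [BCSGame.obsA, conjStrategy, Matrix.sum_apply, Matrix.smul_apply,
        Matrix.map_apply, AddSubmonoidClass.coe_finsetSum, Finset.sum_apply, star_sum,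
        SetLike.val_smul, Pi.smul_apply, smul_eq_mul, star_mul', star_sgn]
    rw [h, littleFrob_map_star_sub]
    exact (h₂ ⟨i, l⟩ ω).trans (mul_le_mul_of_nonneg_right
      ((le_max_right _ _).trans (le_max_right _ _)) hε0)

end BCS

/-! ### Anticommuting observables -/

section Clifford

/-- Anticommuting Hermitian involutions, by the Jordan–Wigner recursion. -/
theorem exists_anticommuting_fin (N : ℕ) :
    ∃ (ι : Type) (_ : Fintype ι) (_ : DecidableEq ι) (_ : Nonempty ι) (γ : Fin N → Matrix ι ι ℂ),
      (∀ k, (γ k)ᴴ = γ k) ∧ ∀ k l, γ k * γ l + γ l * γ k = if k = l then 2 else 0 := by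
  induction N with
  | zero => exact ⟨Unit, inferInstance, inferInstance, inferInstance, Fin.elim0,
      fun k => k.elim0, fun k => k.elim0⟩
  | succ N ih =>
    obtain ⟨ι, _, _, _, γ, h1, h2⟩ := ih
    let σx : Matrix (Fin 2) (Fin 2) ℂ := !![0, 1; 1, 0]
    let σz : Matrix (Fin 2) (Fin 2) ℂ := !![1, 0; 0, -1]
    have hx : σxᴴ = σx := by ext i j; fin_cases i <;> fin_cases j <;> simp [σx]
    have hz : σzᴴ = σz := by ext i j; fin_cases i <;> fin_cases j <;> simp [σz]
    have hxx : σx * σx = 1 := by simp [σx, Matrix.one_fin_two]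
    have hzz : σz * σz = 1 := by simp [σz, Matrix.one_fin_two]
    have hxz : σx * σz + σz * σx = 0 := by
      ext i j; fin_cases i <;> fin_cases j <;> simp [σx, σz]
    -- Tensoring the old matrices with `σz` keeps their relations because `σz * σz = 1`, and `1 ⊗
    -- σx` anticommutes with all of them because `σx` and `σz` anticommute.
    refine ⟨ι × Fin 2, inferInstance, inferInstance, inferInstance,
      Fin.cons (1 ⊗ₖ σx) (fun k => γ k ⊗ₖ σz), fun k => ?_, fun k l => ?_⟩
    · refine Fin.cases ?_ (fun k => ?_) k
      · rw [Fin.cons_zero, Matrix.conjTranspose_kronecker, hx, Matrix.conjTranspose_one]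
      · rw [Fin.cons_succ, Matrix.conjTranspose_kronecker, hz, h1]
    · refine Fin.cases ?_ (fun k => ?_) k <;> refine Fin.cases ?_ (fun l => ?_) l
      · rw [Fin.cons_zero, ← Matrix.mul_kronecker_mul, hxx, one_mul, Matrix.one_kronecker_one,
          if_pos rfl, one_add_one_eq_two]
      · rw [Fin.cons_zero, Fin.cons_succ, ← Matrix.mul_kronecker_mul, ← Matrix.mul_kronecker_mul,
          one_mul, mul_one, ← Matrix.kronecker_add, hxz, Matrix.kronecker_zero,
          if_neg (Fin.succ_ne_zero l).symm]
      · rw [Fin.cons_zero, Fin.cons_succ, ← Matrix.mul_kronecker_mul, ← Matrix.mul_kronecker_mul,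
          one_mul, mul_one, ← Matrix.kronecker_add, add_comm, hxz, Matrix.kronecker_zero,
          if_neg (Fin.succ_ne_zero k)]
      · rw [Fin.cons_succ, Fin.cons_succ, ← Matrix.mul_kronecker_mul, ← Matrix.mul_kronecker_mul,
          hzz, ← Matrix.add_kronecker, h2]
        simp only [Fin.succ_inj]
        split_ifs
        · rw [← one_add_one_eq_two (R := Matrix ι ι ℂ), Matrix.add_kronecker,
            Matrix.one_kronecker_one, one_add_one_eq_two]
        · rw [Matrix.zero_kronecker]

theorem exists_anticommuting (κ : Type*) [Fintype κ] [DecidableEq κ] :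
    ∃ (d : ℕ) (_ : NeZero d) (γ : κ → Matrix (Fin d) (Fin d) ℂ),
      (∀ k, (γ k)ᴴ = γ k) ∧ ∀ k l, γ k * γ l + γ l * γ k = if k = l then 2 else 0 := by
  obtain ⟨ι, _, _, _, γ, h1, h2⟩ := exists_anticommuting_fin (Fintype.card κ)
  let e := Fintype.equivFin ι
  let f := Matrix.reindexAlgEquiv ℂ ℂ e
  refine ⟨Fintype.card ι, ⟨Fintype.card_ne_zero⟩, fun k => f (γ (Fintype.equivFin κ k)),
    fun k => ?_, fun k l => ?_⟩
  · simp only [f, Matrix.coe_reindexAlgEquiv, Matrix.conjTranspose_reindex, h1]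
  · rw [← map_mul, ← map_mul, ← map_add, h2]
    simp only [EmbeddingLike.apply_eq_iff_eq]
    split_ifs
    · exact map_ofNat f 2
    · exact map_zero f

/-- The Clifford relation: off-diagonal terms cancel in pairs. Real unit vectors thus become
involutions, and inner products become normalized traces. -/
theorem anticommuting_combination_mul {κ : Type*} [Fintype κ] [DecidableEq κ] {d : ℕ}
    {γ : κ → Matrix (Fin d) (Fin d) ℂ}
    (hγ : ∀ k l, γ k * γ l + γ l * γ k = if k = l then 2 else 0) (u v : κ → ℝ) :
    (∑ k, (u k : ℂ) • γ k) * (∑ k, (v k : ℂ) • γ k) +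
      (∑ k, (v k : ℂ) • γ k) * (∑ k, (u k : ℂ) • γ k) =
      ((2 * (u ⬝ᵥ v) : ℝ) : ℂ) • (1 : Matrix (Fin d) (Fin d) ℂ) := by
  have h : (∑ k, (v k : ℂ) • γ k) * (∑ k, (u k : ℂ) • γ k) =
      ∑ k, ∑ l, (u k : ℂ) • (v l : ℂ) • (γ l * γ k) := by
    rw [Finset.sum_mul_sum, Finset.sum_comm]
    refine Finset.sum_congr rfl fun k _ => Finset.sum_congr rfl fun l _ => ?_
    rw [smul_mul_smul_comm, smul_smul, mul_comm]
  have h' : (∑ k, (u k : ℂ) • γ k) * (∑ k, (v k : ℂ) • γ k) =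
      ∑ k, ∑ l, (u k : ℂ) • (v l : ℂ) • (γ k * γ l) := by
    rw [Finset.sum_mul_sum]
    refine Finset.sum_congr rfl fun k _ => Finset.sum_congr rfl fun l _ => ?_
    rw [smul_mul_smul_comm, smul_smul]
  rw [h, h', ← Finset.sum_add_distrib]
  simp only [← Finset.sum_add_distrib, ← smul_add, hγ, smul_ite, smul_zero, Finset.sum_ite_eq,
    Finset.mem_univ, if_true]
  have h2 : (2 : Matrix (Fin d) (Fin d) ℂ) = (2 : ℂ) • 1 := by
    rw [two_smul, one_add_one_eq_two]
  simp only [h2, smul_smul, ← Finset.sum_smul, dotProduct]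
  congr 1
  push_cast
  rw [Finset.mul_sum]
  exact Finset.sum_congr rfl fun k _ => by ring

end Clifford

/-! ### Correlation matrices of an XOR game -/

/-- Gram matrices of unit vectors. -/
def IsCorrelation {κ : Type*} [Fintype κ] (M : Matrix κ κ ℝ) : Prop :=
  M.PosSemidef ∧ ∀ a, M a a = 1

section Correlation

variable {κ : Type*} [Fintype κ]

theorem transpose_mul_self_isCorrelation {ι : Type*} [Fintype ι] {B : Matrix ι κ ℝ}
    (hB : ∀ a, ∑ k, B k a * B k a = 1) : IsCorrelation (Bᵀ * B) := by
  refine ⟨?_, fun a => ?_⟩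
  · rw [← Matrix.conjTranspose_eq_transpose_of_trivial]
    exact Matrix.posSemidef_conjTranspose_mul_self B
  · simpa [Matrix.mul_apply] using hB a

open scoped MatrixOrder in
-- The factor can be taken square, so the unit vectors live in a space of fixed dimension;
-- compactness depends on this.
theorem IsCorrelation.exists_factor {M : Matrix κ κ ℝ} (hM : IsCorrelation M) :
    ∃ B : Matrix κ κ ℝ, M = Bᵀ * B ∧ ∀ a, ∑ k, B k a * B k a = 1 := by
  classical
  obtain ⟨B, rfl⟩ := CStarAlgebra.nonneg_iff_eq_star_mul_self.mp hM.1.nonneg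
  refine ⟨B, by rw [Matrix.star_eq_conjTranspose, Matrix.conjTranspose_eq_transpose_of_trivial],
    fun a => ?_⟩
  simpa [Matrix.mul_apply] using hM.2 a

theorem IsCorrelation.midpoint {M N : Matrix κ κ ℝ} (hM : IsCorrelation M) (hN : IsCorrelation N) :
    IsCorrelation ((2⁻¹ : ℝ) • (M + N)) := by
  refine ⟨(hM.1.add hN.1).smul (by norm_num), fun a => ?_⟩
  simp only [Matrix.smul_apply, Matrix.add_apply, hM.2, hN.2]
  norm_num

/-- Two nonnegative quadratic forms whose sum vanishes at `v` both vanish there, and a positive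
semidefinite form vanishes only on the kernel of its matrix. -/
theorem IsCorrelation.mulVec_eq_zero_of_midpoint {M N : Matrix κ κ ℝ} (hM : IsCorrelation M)
    (hN : IsCorrelation N) {v : κ → ℝ} (h : ((2⁻¹ : ℝ) • (M + N)) *ᵥ v = 0) :
    M *ᵥ v = 0 ∧ N *ᵥ v = 0 := by
  have h0 : (M + N) *ᵥ v = 0 := by
    rw [Matrix.smul_mulVec] at h
    exact (smul_eq_zero_iff_right (by norm_num)).1 h
  have h1 : star v ⬝ᵥ M *ᵥ v + star v ⬝ᵥ N *ᵥ v = 0 := by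
    rw [← dotProduct_add, ← Matrix.add_mulVec, h0, dotProduct_zero]
  have h2 := hM.1.dotProduct_mulVec_nonneg v
  have h3 := hN.1.dotProduct_mulVec_nonneg v
  exact ⟨(hM.1.dotProduct_mulVec_zero_iff v).1 (by linarith),
    (hN.1.dotProduct_mulVec_zero_iff v).1 (by linarith)⟩

end Correlation

namespace XORGame

variable {m n : ℕ} (G : XORGame m n)

/-- The bias of a correlation matrix. -/
def corrBias (M : Matrix (Fin m ⊕ Fin n) (Fin m ⊕ Fin n) ℝ) : ℝ :=
  ∑ i, ∑ j, G.cost i j * M (Sum.inl i) (Sum.inr j)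

/-- The coefficients of `∑_j g_ij v_j - t u_i`. -/
def rowVec (i : Fin m) (t : ℝ) : Fin m ⊕ Fin n → ℝ :=
  Sum.elim (fun i' => if i' = i then -t else 0) (fun j => G.cost i j)

theorem corrBias_midpoint (M N : Matrix (Fin m ⊕ Fin n) (Fin m ⊕ Fin n) ℝ) :
    G.corrBias ((2⁻¹ : ℝ) • (M + N)) = (G.corrBias M + G.corrBias N) / 2 := by
  simp only [corrBias, ← Finset.sum_add_distrib, Finset.sum_div]
  refine Finset.sum_congr rfl fun i _ => Finset.sum_congr rfl fun j _ => ?_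
  simp only [Matrix.smul_apply, Matrix.add_apply, smul_eq_mul]
  ring

/-- The square matrices with unit columns form a closed subset of a cube, the bias of their Gram
matrix is continuous, and every correlation matrix is such a Gram matrix. -/
theorem exists_max_correlation : ∃ M : Matrix (Fin m ⊕ Fin n) (Fin m ⊕ Fin n) ℝ,
    IsCorrelation M ∧ ∀ N, IsCorrelation N → G.corrBias N ≤ G.corrBias M := by
  classical
  let K : Set (Fin m ⊕ Fin n → Fin m ⊕ Fin n → ℝ) := {B | ∀ a, ∑ k, B k a * B k a = 1}
  have hK : IsCompact K := by
    refine IsCompact.of_isClosed_subset (isCompact_univ_pi fun _ => isCompact_univ_pi fun _ =>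
      isCompact_Icc (a := (-1 : ℝ)) (b := 1)) ?_ ?_
    · have : K = ⋂ a, {B | ∑ k, B k a * B k a = 1} := by ext B; simp [K]
      rw [this]
      exact isClosed_iInter fun a => isClosed_eq (by fun_prop) continuous_const
    · intro B hB k _ a _
      have h1 : B k a * B k a ≤ 1 := by
        rw [← hB a]
        exact Finset.single_le_sum (f := fun k => B k a * B k a)
          (fun k _ => mul_self_nonneg _) (Finset.mem_univ k)
      exact abs_le.1 (abs_le_one_iff_mul_self_le_one.2 h1)
  have hne : K.Nonempty := ⟨fun k a => if k = a then 1 else 0, fun a => by simp⟩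
  have hcont : Continuous fun B : Fin m ⊕ Fin n → Fin m ⊕ Fin n → ℝ =>
      G.corrBias ((Matrix.of B)ᵀ * Matrix.of B) := by
    simp only [corrBias, Matrix.mul_apply, Matrix.transpose_apply, Matrix.of_apply]
    fun_prop
  obtain ⟨B, hB, hmax⟩ := hK.exists_isMaxOn hne hcont.continuousOn
  refine ⟨(Matrix.of B)ᵀ * Matrix.of B, transpose_mul_self_isCorrelation hB, fun N hN => ?_⟩
  obtain ⟨B', rfl, hB'⟩ := hN.exists_factor
  exact hmax (show (fun k a => B' k a) ∈ K from hB')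

/-- At an optimal correlation, each row vector is aligned with Alice's vector. -/
theorem exists_rowVec_mulVec_eq_zero {M : Matrix (Fin m ⊕ Fin n) (Fin m ⊕ Fin n) ℝ}
    (hM : IsCorrelation M) (hmax : ∀ N, IsCorrelation N → G.corrBias N ≤ G.corrBias M)
    (i : Fin m) : ∃ t : ℝ, M *ᵥ G.rowVec i t = 0 := by
  obtain ⟨B, rfl, hB⟩ := hM.exists_factor
  let z : Fin m → Fin m ⊕ Fin n → ℝ := fun i k => ∑ j, G.cost i j * B k (Sum.inr j)
  have hbias : ∀ B' : Matrix (Fin m ⊕ Fin n) (Fin m ⊕ Fin n) ℝ,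
      (∀ k j, B' k (Sum.inr j) = B k (Sum.inr j)) →
      G.corrBias (B'ᵀ * B') = ∑ i, ∑ k, B' k (Sum.inl i) * z i k := fun B' hB' => by
    refine Finset.sum_congr rfl fun i _ => ?_
    simp only [z, Matrix.mul_apply, Matrix.transpose_apply, hB', Finset.mul_sum]
    rw [Finset.sum_comm]
    exact Finset.sum_congr rfl fun k _ => Finset.sum_congr rfl fun j _ => by ring
  have hrow : ∀ t k, (B *ᵥ G.rowVec i t) k = z i k - t * B k (Sum.inl i) := fun t k => by
    simp only [Matrix.mulVec, dotProduct, Fintype.sum_sum_type, rowVec, Sum.elim_inl,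
      Sum.elim_inr, mul_ite, mul_zero, Finset.sum_ite_eq', Finset.mem_univ, if_true, z]
    rw [add_comm, sub_eq_add_neg]
    congr 1
    · exact Finset.sum_congr rfl fun j _ => mul_comm _ _
    · ring
  set q := ∑ k, z i k * z i k with hq
  have hq0 : 0 ≤ q := Finset.sum_nonneg fun k _ => mul_self_nonneg _
  set p := ∑ k, B k (Sum.inl i) * z i k with hp
  set t := Real.sqrt q with ht
  have htt : t * t = q := Real.mul_self_sqrt hq0
  have ht0 : 0 ≤ t := Real.sqrt_nonneg q
  -- With `t` the length of the row vector `z i`, replacing Alice's vector by `z i / t` would raise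
  -- her contribution from `p` to `t`; maximality forbids a gain. The factor `t` covers the case `z
  -- i = 0`.
  have hpt : t * t ≤ t * p := by
    rcases ht0.eq_or_lt with h0 | h0
    · rw [← h0]; simp
    let B' : Matrix (Fin m ⊕ Fin n) (Fin m ⊕ Fin n) ℝ :=
      B.updateCol (Sum.inl i) (fun k => z i k / t)
    have hB' : ∀ a, ∑ k, B' k a * B' k a = 1 := fun a => by
      by_cases ha : a = Sum.inl i
      · subst ha
        simp only [B', Matrix.updateCol_self, div_mul_div_comm, ← Finset.sum_div]
        rw [← hq, htt, div_self]
        rw [← htt]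
        positivity
      · simp only [B', Matrix.updateCol_ne ha]
        exact hB a
    have h1 := hmax _ (transpose_mul_self_isCorrelation hB')
    rw [hbias B fun _ _ => rfl, hbias B' fun k j => by simp [B', Matrix.updateCol_ne],
      ← sub_nonneg, ← Finset.sum_sub_distrib, Finset.sum_eq_single i] at h1
    · simp only [B', Matrix.updateCol_self, div_mul_eq_mul_div, ← Finset.sum_div] at h1
      rw [← hq, ← hp, ← htt, mul_div_assoc, div_self h0.ne', mul_one, sub_nonneg] at h1
      exact mul_le_mul_of_nonneg_left h1 ht0
    · intro i' _ hi'
      have : (Sum.inl i' : Fin m ⊕ Fin n) ≠ Sum.inl i := fun h => hi' (Sum.inl_injective h)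
      simp [B', Matrix.updateCol_ne this]
    · simp
  refine ⟨t, ?_⟩
  -- The squared distance `q - 2 t p + t²` is at most zero, since `q = t²` and `t² ≤ t p`.
  have h2 : ∑ k, (z i k - t * B k (Sum.inl i)) ^ 2 = q - 2 * (t * p) + t * t := by
    have h3 : ∀ k, (z i k - t * B k (Sum.inl i)) ^ 2 = z i k * z i k -
        2 * (t * (B k (Sum.inl i) * z i k)) + t * t * (B k (Sum.inl i) * B k (Sum.inl i)) :=
      fun k => by ring
    simp only [h3, Finset.sum_add_distrib, Finset.sum_sub_distrib, ← Finset.mul_sum]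
    rw [hB, mul_one]
  have h4 : ∀ k, z i k - t * B k (Sum.inl i) = 0 := fun k => by
    have h5 : ∑ k, (z i k - t * B k (Sum.inl i)) ^ 2 = 0 :=
      le_antisymm (by rw [h2]; linarith) (Finset.sum_nonneg fun k _ => sq_nonneg _)
    rw [Finset.sum_eq_zero_iff_of_nonneg fun k _ => sq_nonneg _] at h5
    exact pow_eq_zero_iff (two_ne_zero) |>.1 (h5 k (Finset.mem_univ k))
  have h6 : B *ᵥ G.rowVec i t = 0 := funext fun k => by rw [hrow, h4]; rfl
  rw [← Matrix.mulVec_mulVec, h6, Matrix.mulVec_zero]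

/-- The row biases are the same at all optimal correlations. -/
theorem exists_row_biases_of_correlations : ∃ c : Fin m → ℝ,
    ∀ M, IsCorrelation M → (∀ N, IsCorrelation N → G.corrBias N ≤ G.corrBias M) →
      ∀ i, M *ᵥ G.rowVec i (c i) = 0 := by
  obtain ⟨M₀, h₀, hmax₀⟩ := G.exists_max_correlation
  choose c hc using G.exists_rowVec_mulVec_eq_zero h₀ hmax₀
  refine ⟨c, fun M hM hmax i => ?_⟩
  have hmid : ∀ N, IsCorrelation N → G.corrBias N ≤ G.corrBias ((2⁻¹ : ℝ) • (M + M₀)) := by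
    intro N hN
    rw [corrBias_midpoint]
    linarith [hmax N hN, hmax₀ N hN]
  -- The midpoint with the reference optimum `M₀` is optimal, and its kernel vector lies in both
  -- kernels, so `M` and `M₀` share the value `t`.
  obtain ⟨t, ht⟩ := G.exists_rowVec_mulVec_eq_zero (hM.midpoint h₀) hmid i
  obtain ⟨h1, h2⟩ := hM.mulVec_eq_zero_of_midpoint h₀ ht
  -- The difference is a multiple of one basis vector, and the unit diagonal of `M₀` forces the
  -- multiple to be zero.
  have h3 : M₀ *ᵥ (G.rowVec i t - G.rowVec i (c i)) = 0 := by
    rw [Matrix.mulVec_sub, h2, hc, sub_zero]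
  have h4 : G.rowVec i t - G.rowVec i (c i) = Pi.single (Sum.inl i) (c i - t) := by
    ext a
    rcases a with a | a
    · by_cases ha : a = i
      · subst ha; simp [rowVec]; ring
      · simp [rowVec, ha]
    · simp [rowVec]
  have h5 := congrFun h3 (Sum.inl i)
  rw [h4, Matrix.mulVec_single] at h5
  simp [Matrix.col, h₀.2] at h5
  have h6 : t = c i := by linarith
  rw [← h6]
  exact h1

end XORGame

/-! ### Strategies and correlations of an XOR game -/

namespace XORStrategy

variable {m n dA dB : ℕ} (S : XORStrategy m n dA dB)

/-- The vectors `(Y_i ⊗ 1) ψ` and `(1 ⊗ X_j) ψ`. -/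
def vec : Fin m ⊕ Fin n → Fin dA × Fin dB → ℂ :=
  Sum.elim (fun i => (S.Y i ⊗ₖ (1 : Matrix (Fin dB) (Fin dB) ℂ)) *ᵥ S.ψ)
    (fun j => ((1 : Matrix (Fin dA) (Fin dA) ℂ) ⊗ₖ S.X j) *ᵥ S.ψ)

/-- Real coordinates of the vectors of a strategy. -/
def coord : Matrix ((Fin dA × Fin dB) × Bool) (Fin m ⊕ Fin n) ℝ :=
  Matrix.of fun p a => if p.2 then (S.vec a p.1).re else (S.vec a p.1).im

theorem star_mulVec_dotProduct {ι : Type*} [Fintype ι] (A B : Matrix ι ι ℂ) (v w : ι → ℂ) :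
    star (A *ᵥ v) ⬝ᵥ (B *ᵥ w) = star v ⬝ᵥ ((Aᴴ * B) *ᵥ w) := by
  rw [Matrix.star_mulVec, ← Matrix.dotProduct_mulVec, Matrix.mulVec_mulVec]

theorem vec_unit (a : Fin m ⊕ Fin n) : star (S.vec a) ⬝ᵥ S.vec a = 1 := by
  rcases a with i | j
  · simp only [vec, Sum.elim_inl]
    rw [star_mulVec_dotProduct, Matrix.conjTranspose_kronecker, S.Y_herm,
      Matrix.conjTranspose_one, ← Matrix.mul_kronecker_mul, S.Y_sq, one_mul,
      Matrix.one_kronecker_one, Matrix.one_mulVec, S.ψ_unit]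
  · simp only [vec, Sum.elim_inr]
    rw [star_mulVec_dotProduct, Matrix.conjTranspose_kronecker, S.X_herm,
      Matrix.conjTranspose_one, ← Matrix.mul_kronecker_mul, S.X_sq, one_mul,
      Matrix.one_kronecker_one, Matrix.one_mulVec, S.ψ_unit]

theorem re_vec_inl_dotProduct_vec_inr (i : Fin m) (j : Fin n) :
    (star (S.vec (Sum.inl i)) ⬝ᵥ S.vec (Sum.inr j)).re = expect S.ψ (S.Y i) (S.X j) := by
  simp only [vec, Sum.elim_inl, Sum.elim_inr]
  rw [star_mulVec_dotProduct, Matrix.conjTranspose_kronecker, S.Y_herm,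
    Matrix.conjTranspose_one, ← Matrix.mul_kronecker_mul, mul_one, one_mul, expect]

theorem coord_transpose_mul (a b : Fin m ⊕ Fin n) :
    (S.coordᵀ * S.coord) a b = (star (S.vec a) ⬝ᵥ S.vec b).re := by
  rw [Matrix.mul_apply, Fintype.sum_prod_type, dotProduct, Complex.re_sum]
  refine Finset.sum_congr rfl fun p _ => ?_
  simp [coord]

theorem isCorrelation : IsCorrelation (S.coordᵀ * S.coord) := by
  refine transpose_mul_self_isCorrelation fun a => ?_
  have h := S.coord_transpose_mul a a
  rw [vec_unit, Matrix.mul_apply] at h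
  exact h

/-- The kernel of a Gram matrix consists of the linear relations among its vectors. Real
coefficients act separately on real and imaginary parts, so the relation holds for the complex
vectors. -/
theorem sum_smul_vec_eq_zero {v : Fin m ⊕ Fin n → ℝ} (hv : (S.coordᵀ * S.coord) *ᵥ v = 0) :
    ∑ a, (v a : ℂ) • S.vec a = 0 := by
  rw [← Matrix.conjTranspose_eq_transpose_of_trivial,
    Matrix.conjTranspose_mul_self_mulVec_eq_zero] at hv
  ext p
  have h1 := congrFun hv (p, true)
  have h2 := congrFun hv (p, false)
  simp only [Matrix.mulVec, dotProduct, coord, Matrix.of_apply, if_true, Bool.false_eq_true,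
    if_false, Pi.zero_apply] at h1 h2
  rw [Finset.sum_apply]
  apply Complex.ext
  · simp only [Complex.re_sum, Pi.smul_apply, smul_eq_mul, Complex.re_ofReal_mul, Pi.zero_apply,
      Complex.zero_re]
    rw [← h1]
    exact Finset.sum_congr rfl fun a _ => mul_comm _ _
  · simp only [Complex.im_sum, Pi.smul_apply, smul_eq_mul, Complex.im_ofReal_mul, Pi.zero_apply,
      Complex.zero_im]
    rw [← h2]
    exact Finset.sum_congr rfl fun a _ => mul_comm _ _

theorem vec_ne_zero (a : Fin m ⊕ Fin n) : S.vec a ≠ 0 := fun h => by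
  have h1 := S.vec_unit a
  rw [h] at h1
  simp at h1

end XORStrategy

/-- The strategy with the maximally entangled state and conjugated observables for Alice. -/
def conjXORStrategy {m n d : ℕ} [NeZero d] (Y : Fin m → Matrix (Fin d) (Fin d) ℂ)
    (X : Fin n → Matrix (Fin d) (Fin d) ℂ) (Y_herm : ∀ i, (Y i)ᴴ = Y i)
    (Y_sq : ∀ i, Y i * Y i = 1) (X_herm : ∀ j, (X j)ᴴ = X j) (X_sq : ∀ j, X j * X j = 1) :
    XORStrategy m n d d where
  Y i := (Y i).map star
  X := X
  Y_herm i := by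
    conv_rhs => rw [← Y_herm i]
    ext s t
    simp
  Y_sq i := by
    have h : (Y i * Y i).map (starRingEnd ℂ) = 1 := by
      rw [Y_sq]; ext s t; simp [Matrix.one_apply]
    rwa [Matrix.map_mul] at h
  X_herm := X_herm
  X_sq := X_sq
  ψ := maxEntangled d
  ψ_unit := maxEntangled_unit

/-! ### Attaining the optimal bias, and the marginal row biases. -/

namespace XORGame

variable {m n : ℕ} (G : XORGame m n)

theorem corrBias_coord {dA dB : ℕ} (S : XORStrategy m n dA dB) :
    G.corrBias (S.coordᵀ * S.coord) = G.bias S := by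
  simp only [corrBias, bias, S.coord_transpose_mul, S.re_vec_inl_dotProduct_vec_inr]

theorem bias_conjXORStrategy {d : ℕ} [NeZero d] {Y : Fin m → Matrix (Fin d) (Fin d) ℂ}
    {X : Fin n → Matrix (Fin d) (Fin d) ℂ} (Y_herm : ∀ i, (Y i)ᴴ = Y i)
    (Y_sq : ∀ i, Y i * Y i = 1) (X_herm : ∀ j, (X j)ᴴ = X j) (X_sq : ∀ j, X j * X j = 1) :
    G.bias (conjXORStrategy Y X Y_herm Y_sq X_herm X_sq) =
      ∑ i, ((Y i)ᴴ * ∑ j, (G.cost i j : ℂ) • X j).trace.re / d := by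
  refine Finset.sum_congr rfl fun i _ => ?_
  rw [Finset.mul_sum, Matrix.trace_sum, Complex.re_sum, Finset.sum_div]
  refine Finset.sum_congr rfl fun j _ => ?_
  simp only [conjXORStrategy]
  rw [expect_maxEntangled, Matrix.mul_smul, Matrix.trace_smul, smul_eq_mul, Complex.re_ofReal_mul,
    mul_div_assoc]

/-- Every correlation matrix is attained by a strategy. -/
theorem exists_strategy_of_correlation {M : Matrix (Fin m ⊕ Fin n) (Fin m ⊕ Fin n) ℝ}
    (hM : IsCorrelation M) : ∃ (d : ℕ) (S : XORStrategy m n d d), G.bias S = G.corrBias M := by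
  obtain ⟨B, rfl, hB⟩ := hM.exists_factor
  obtain ⟨d, _, γ, h1, h2⟩ := exists_anticommuting (Fin m ⊕ Fin n)
  let O : Fin m ⊕ Fin n → Matrix (Fin d) (Fin d) ℂ := fun a => ∑ k, (B k a : ℂ) • γ k
  have hO : ∀ a, (O a)ᴴ = O a := fun a => by
    simp [O, Matrix.conjTranspose_sum, Matrix.conjTranspose_smul, h1]
  have hOO : ∀ a b, O a * O b + O b * O a = ((2 * (Bᵀ * B) a b : ℝ) : ℂ) • 1 := fun a b => by
    simp only [O, anticommuting_combination_mul h2 (fun k => B k a) (fun k => B k b)]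
    rfl
  have hsq : ∀ a, O a * O a = 1 := fun a => by
    have h := hOO a a
    rw [hM.2, ← two_smul ℂ, mul_one, Complex.ofReal_ofNat] at h
    exact smul_right_injective _ (two_ne_zero (α := ℂ)) h
  -- Under the trace both halves of the anticommutator agree.
  have htr : ∀ a b, (O a * O b).trace.re / d = (Bᵀ * B) a b := fun a b => by
    have h := congrArg (fun A => (Matrix.trace A).re) (hOO a b)
    simp only [Matrix.trace_add, Matrix.trace_mul_comm (O b), Matrix.trace_smul,
      Matrix.trace_one, Fintype.card_fin, Complex.add_re, smul_eq_mul, Complex.re_ofReal_mul,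
      Complex.natCast_re] at h
    rw [div_eq_iff (NeZero.ne (d : ℝ))]
    linarith
  refine ⟨d, conjXORStrategy (fun i => O (Sum.inl i)) (fun j => O (Sum.inr j)) (fun i => hO _)
    (fun i => hsq _) (fun j => hO _) (fun j => hsq _), ?_⟩
  rw [bias_conjXORStrategy, corrBias]
  refine Finset.sum_congr rfl fun i _ => ?_
  rw [Finset.mul_sum, Matrix.trace_sum, Complex.re_sum, Finset.sum_div]
  refine Finset.sum_congr rfl fun j _ => ?_
  rw [Matrix.mul_smul, Matrix.trace_smul, smul_eq_mul, Complex.re_ofReal_mul,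
    mul_div_assoc, hO, htr]

/-- The optimal bias is attained, and bounds the bias of every strategy and correlation. -/
theorem exists_optimal_strategy :
    (∃ (d : ℕ) (S : XORStrategy m n d d), G.bias S = G.optimalBias) ∧
      (∀ {dA dB : ℕ} (S : XORStrategy m n dA dB), G.bias S ≤ G.optimalBias) ∧
      ∀ N, IsCorrelation N → G.corrBias N ≤ G.optimalBias := by
  obtain ⟨M, hM, hmax⟩ := G.exists_max_correlation
  obtain ⟨d, S, hS⟩ := G.exists_strategy_of_correlation hM
  have h : IsGreatest {β : ℝ | ∃ (dA dB : ℕ) (S : XORStrategy m n dA dB), G.bias S = β}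
      (G.corrBias M) := by
    refine ⟨⟨d, d, S, hS⟩, ?_⟩
    rintro _ ⟨dA, dB, S', rfl⟩
    rw [← G.corrBias_coord S']
    exact hmax _ S'.isCorrelation
  have h' : G.optimalBias = G.corrBias M := h.csSup_eq
  rw [h']
  exact ⟨⟨d, S, hS⟩, fun {dA dB} S' => h.2 ⟨dA, dB, S', rfl⟩, hmax⟩

theorem sum_rowVec_smul_vec {dA dB : ℕ} (S : XORStrategy m n dA dB) (i : Fin m) (t : ℝ) :
    ∑ a, (G.rowVec i t a : ℂ) • S.vec a =
      ∑ j, (G.cost i j : ℂ) • S.vec (Sum.inr j) - (t : ℂ) • S.vec (Sum.inl i) := by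
  rw [Fintype.sum_sum_type, add_comm, sub_eq_add_neg]
  congr 1
  rw [Finset.sum_eq_single i]
  · simp [rowVec]
  · intro i' _ hi'
    simp [rowVec, hi']
  · simp

/-- The Gram matrix of an optimal strategy is an optimal correlation, whose kernel vectors are the
required identities. Uniqueness needs an optimal strategy to exist, and then follows because `(Y_i ⊗
1) ψ` is nonzero. -/
theorem existsUnique_rowBiases : ∃! c : Fin m → ℝ, G.IsRowBiases c := by
  obtain ⟨⟨d, S₀, hS₀⟩, -, hle⟩ := G.exists_optimal_strategy
  obtain ⟨c, hc⟩ := G.exists_row_biases_of_correlations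
  have hcrow : G.IsRowBiases c := by
    intro dA dB S hS i
    have h1 := S.sum_smul_vec_eq_zero (hc _ S.isCorrelation (fun N hN => by
      rw [corrBias_coord, hS]; exact hle N hN) i)
    rw [sum_rowVec_smul_vec, sub_eq_zero] at h1
    exact h1
  refine ⟨c, hcrow, fun c' hc' => funext fun i => ?_⟩
  have h1 := (hcrow d d S₀ hS₀ i).symm.trans (hc' d d S₀ hS₀ i)
  have h2 := smul_left_injective ℂ (S₀.vec_ne_zero (Sum.inl i)) h1
  exact_mod_cast h2.symm

/-- Pair the row identity of an optimal strategy with the unit vector `(Y_i ⊗ 1) ψ` and sum over the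
rows. -/
theorem IsRowBiases.sum_eq_optimalBias {G : XORGame m n} {c : Fin m → ℝ} (hc : G.IsRowBiases c) :
    G.optimalBias = ∑ i, c i := by
  obtain ⟨⟨d, S, hS⟩, -, -⟩ := G.exists_optimal_strategy
  rw [← hS]
  refine Finset.sum_congr rfl fun i _ => ?_
  have h1 : ∑ j, (G.cost i j : ℂ) • S.vec (Sum.inr j) = (c i : ℂ) • S.vec (Sum.inl i) :=
    hc d d S hS i
  have h2 := congrArg (fun v => (star (S.vec (Sum.inl i)) ⬝ᵥ v).re) h1
  simp only [dotProduct_sum, dotProduct_smul, smul_eq_mul, Complex.re_sum, Complex.re_ofReal_mul,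
    S.re_vec_inl_dotProduct_vec_inr, S.vec_unit, mul_one] at h2
  exact h2

/-! ### Approximate representations of the solution algebra -/

theorem littleFrob_eq_one_of_involution {d : ℕ} [NeZero d] {Y : Matrix (Fin d) (Fin d) ℂ}
    (h1 : Yᴴ = Y) (h2 : Y * Y = 1) : littleFrob Y = 1 := by
  rw [littleFrob, h1, h2, Matrix.trace_one, Fintype.card_fin, Complex.natCast_re,
    div_self (NeZero.ne _), Real.sqrt_one]

/-- Replacing `A` by the involution `Y` nearest to `t⁻¹ A` costs little in the inner product. -/
theorem sub_littleFrob_le_trace_re {d : ℕ} [NeZero d] {Y : Matrix (Fin d) (Fin d) ℂ}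
    (h1 : Yᴴ = Y) (h2 : Y * Y = 1) (A : Matrix (Fin d) (Fin d) ℂ) (t : ℝ) :
    t - littleFrob (A - (t : ℂ) • Y) ≤ (Yᴴ * A).trace.re / d := by
  have h3 : (Yᴴ * A).trace.re / d = t + (Yᴴ * (A - (t : ℂ) • Y)).trace.re / d := by
    rw [Matrix.mul_sub, Matrix.trace_sub, Matrix.mul_smul, h1, h2, Matrix.trace_smul,
      Matrix.trace_one, Fintype.card_fin, Complex.sub_re, smul_eq_mul, Complex.re_ofReal_mul,
      Complex.natCast_re, sub_div, mul_div_assoc, div_self (NeZero.ne (d : ℝ))]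
    ring
  have h4 := norm_trace_conjTranspose_mul_le Y (A - (t : ℂ) • Y)
  rw [littleFrob_eq_one_of_involution h1 h2, one_mul] at h4
  have h5 : -(‖(Yᴴ * (A - (t : ℂ) • Y)).trace‖ / d) ≤ (Yᴴ * (A - (t : ℂ) • Y)).trace.re / d := by
    rw [← neg_div]
    gcongr
    exact (abs_le.1 (Complex.abs_re_le_norm _)).1
  linarith

variable {Ω : Type*} {d : Ω → ℕ} {ε : Ω → ℝ}

theorem smallFam_sum_smul {ι : Type*} [Fintype ι] (c : ι → ℂ) {x : ι → Fam d}
    (hx : ∀ k, SmallFam ε (x k)) : SmallFam ε (∑ k, c k • x k) :=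
  Finset.sum_induction _ _ (fun _ _ => SmallFam.add) smallFam_zero fun k _ => (hx k).smul (c k)

/-- Alice's observable for a row: the rounding of `t⁻¹ A` if `t ≠ 0`, and a sign otherwise. -/
theorem exists_row_observable [∀ ω, NeZero (d ω)] (hε : ∀ ω, 0 ≤ ε ω) {A : bddFam d}
    (hA : star A = A) {t : ℝ} (hAt : cls d ε A * cls d ε A = algebraMap ℂ _ ((t : ℂ) ^ 2)) :
    ∃ Y : Fam d, star Y = Y ∧ Y * Y = 1 ∧
      (t ≠ 0 → SmallFam ε (Y - (t : ℂ)⁻¹ • (A : Fam d))) ∧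
      ∃ C : ℝ, 0 ≤ C ∧ ∀ ω, t - C * ε ω ≤ ((Y ω)ᴴ * (A : Fam d) ω).trace.re / d ω := by
  by_cases ht : t = 0
  · refine ⟨fun ω => if 0 ≤ ((A : Fam d) ω).trace.re then 1 else -1, ?_, ?_,
      fun h => absurd ht h, 0, le_rfl, fun ω => ?_⟩
    · ext1 ω
      simp only [Pi.star_apply]
      split_ifs <;> simp
    · ext1 ω
      simp only [Pi.mul_apply, Pi.one_apply]
      split_ifs <;> simp
    · rw [ht, zero_mul, sub_zero]
      refine div_nonneg ?_ (Nat.cast_nonneg _)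
      dsimp only
      split_ifs with h
      · simpa using h
      · simp only [Matrix.conjTranspose_neg, Matrix.conjTranspose_one, Matrix.neg_mul,
          Matrix.one_mul, Matrix.trace_neg, Complex.neg_re]
        linarith
  · have htC : (t : ℂ) ≠ 0 := by exact_mod_cast ht
    have h1 : SmallFam ε (((t : ℂ)⁻¹ • (A : Fam d)) * ((t : ℂ)⁻¹ • (A : Fam d)) - 1) := by
      have ht2 : (t : ℂ)⁻¹ * (t : ℂ)⁻¹ * (t : ℂ) ^ 2 = 1 := by field_simp
      have h0 : cls d ε (((t : ℂ)⁻¹ • A) * ((t : ℂ)⁻¹ • A) - 1) = 0 := by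
        rw [map_sub, map_mul, map_smul, map_one, smul_mul_smul_comm, hAt,
          Algebra.algebraMap_eq_smul_one, smul_smul, ht2, one_smul, sub_self]
      simpa only [AddSubgroupClass.coe_sub, MulMemClass.coe_mul, SetLike.val_smul,
        OneMemClass.coe_one] using (cls_eq_zero_iff hε).1 h0
    have hA' : star (A : Fam d) = A := congrArg Subtype.val hA
    have h2 : SmallFam ε (star ((t : ℂ)⁻¹ • (A : Fam d)) - (t : ℂ)⁻¹ • (A : Fam d)) := by
      rw [star_smul, hA']
      simpa using smallFam_zero
    obtain ⟨Y, hY1, hY2, hY3⟩ := exists_involution_family_near h1 h2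
    have hY1' : star (Y : Fam d) = Y := congrArg Subtype.val hY1
    have hY2' : (Y : Fam d) * (Y : Fam d) = 1 := congrArg Subtype.val hY2
    refine ⟨Y, hY1', hY2', fun _ => hY3, ?_⟩
    have h3 : SmallFam ε ((A : Fam d) - (t : ℂ) • (Y : Fam d)) := by
      have h4 := hY3.smul (-(t : ℂ))
      rwa [neg_smul, smul_sub, neg_sub, smul_smul, mul_inv_cancel₀ htC, one_smul] at h4
    obtain ⟨C, hC, h4⟩ := h3
    refine ⟨C, hC, fun ω => le_trans (sub_le_sub_left (h4 ω) t) ?_⟩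
    exact sub_littleFrob_le_trace_re (congrFun hY1' ω) (congrFun hY2' ω) _ t

/-- The squared row relation holds exactly in the quotient for the rounded `X j`, so each row
combination can be rounded to an observable of Alice. Closeness to `φ` itself follows by linearity
from closeness of `X j` to `φ j`. -/
theorem exists_observable_families [∀ ω, NeZero (d ω)] (hε : ∀ ω, 0 ≤ ε ω) (c : Fin m → ℝ)
    (φ : Fin n → Fam d) (hφ : ∀ r ∈ (G.algebra c).rel, SmallFam ε (evalFam φ r)) :
    ∃ (X : Fin n → Fam d) (Y : Fin m → Fam d),
      (∀ j, star (X j) = X j) ∧ (∀ j, X j * X j = 1) ∧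
      (∀ i, star (Y i) = Y i) ∧ (∀ i, Y i * Y i = 1) ∧
      (∀ j, SmallFam ε (X j - φ j)) ∧
      (∀ i, c i ≠ 0 → SmallFam ε (Y i - (c i : ℂ)⁻¹ • ∑ j, (G.cost i j : ℂ) • φ j)) ∧
      ∀ i, ∃ C : ℝ, 0 ≤ C ∧ ∀ ω,
        c i - C * ε ω ≤ ((Y i ω)ᴴ * ∑ j, (G.cost i j : ℂ) • X j ω).trace.re / d ω := by
  have hsq : ∀ j, SmallFam ε (φ j * φ j - 1) := fun j => by
    simpa using hφ (gen j * gen j - 1) (Or.inl (Or.inr ⟨j, rfl⟩))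
  have hstar : ∀ j, SmallFam ε (star (φ j) - φ j) := fun j => by
    simpa using hφ (genStar j - gen j) (Or.inl (Or.inl ⟨j, rfl⟩))
  choose X hX1 hX2 hX3 using fun j => exists_involution_family_near (hsq j) (hstar j)
  have hA : ∀ i, star (∑ j, (G.cost i j : ℂ) • X j) = ∑ j, (G.cost i j : ℂ) • X j := fun i => by
    simp [star_sum, star_smul, hX1]
  have hrow : ∀ i, cls d ε (∑ j, (G.cost i j : ℂ) • X j) * cls d ε (∑ j, (G.cost i j : ℂ) • X j) =
      algebraMap ℂ _ ((c i : ℂ) ^ 2) := fun i => by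
    have h := lift_cls_eq_zero hX1 hX3 (hφ ((∑ j, (G.cost i j : ℂ) • gen j) *
      (∑ j, (G.cost i j : ℂ) • gen j) - algebraMap ℂ (FreeStar (Fin n)) ((c i : ℂ) ^ 2))
      (Or.inr ⟨i, rfl⟩))
    rw [map_sub, map_mul, AlgHom.commutes, sub_eq_zero, map_sum] at h
    simp only [map_smul, lift_gen] at h
    rw [map_sum]
    simp only [map_smul]
    exact h
  choose Y hY1 hY2 hY3 hY4 using fun i => exists_row_observable hε (hA i) (hrow i)
  refine ⟨fun j => X j, Y, fun j => congrArg Subtype.val (hX1 j),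
    fun j => congrArg Subtype.val (hX2 j), hY1, hY2, hX3, fun i hi => ?_, fun i => ?_⟩
  · have h := (hY3 i hi).add
      ((smallFam_sum_smul (fun j => (G.cost i j : ℂ)) hX3).smul (c i : ℂ)⁻¹)
    have h' : Y i - (c i : ℂ)⁻¹ • ∑ j, (G.cost i j : ℂ) • φ j =
        Y i - (c i : ℂ)⁻¹ • ((∑ j, (G.cost i j : ℂ) • X j : bddFam d) : Fam d) +
          (c i : ℂ)⁻¹ • ∑ j, (G.cost i j : ℂ) • ((X j : Fam d) - φ j) := by
      simp only [AddSubmonoidClass.coe_finsetSum, SetLike.val_smul, smul_sub,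
        Finset.sum_sub_distrib]
      abel
    rw [h']
    exact h
  · obtain ⟨C, hC, h⟩ := hY4 i
    refine ⟨C, hC, fun ω => ?_⟩
    simpa using h ω

/-- The row estimates bound the bias below by `∑ i, c i` minus `O(ε)`, and `∑ i, c i` is the optimal
bias; the upper bound is optimality itself. -/
theorem exists_approx_strategy {c : Fin m → ℝ} (hc : G.IsRowBiases c) :
    ∃ C : ℝ, ∀ (d : ℕ) [NeZero d] (ε : ℝ) (φ : Fin n → Matrix (Fin d) (Fin d) ℂ), 0 ≤ ε →
      (G.algebra c).IsApproxRep ε φ →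
      ∃ S : XORStrategy m n d d,
        S.ψ = maxEntangled d ∧ IsMaximallyEntangled S.ψ ∧
        G.IsOptimalUpTo (C * ε) S ∧
        (∀ j, littleFrob (S.X j - φ j) ≤ C * ε) ∧
        (∀ i, c i ≠ 0 → littleFrob
          (S.Y i - ((c i : ℂ)⁻¹ • ∑ j, (G.cost i j : ℂ) • φ j).map star) ≤ C * ε) := by
  obtain ⟨X, Y, hX1, hX2, hY1, hY2, hXφ, hYφ, hbias⟩ := G.exists_observable_families
    (fun ω : ApproxRep (G.algebra c) => ω.ε_nonneg) c (ApproxRep.fam (G.algebra c))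
    (fun r hr => ApproxRep.smallFam_evalFam hr)
  obtain ⟨C₁, hC₁, h₁⟩ := exists_uniform_of_smallFam
    (fun ω : ApproxRep (G.algebra c) => ω.ε_nonneg) hXφ
  obtain ⟨C₂, hC₂, h₂⟩ := exists_uniform_of_smallFam
    (fun ω : ApproxRep (G.algebra c) => ω.ε_nonneg)
    (fun i : {i : Fin m // c i ≠ 0} => hYφ i.1 i.2)
  choose K hK h₃ using hbias
  refine ⟨max (∑ i, K i) (max C₁ C₂), fun d _ ε φ hε0 hφ => ?_⟩
  let ω : ApproxRep (G.algebra c) := ⟨d, inferInstance, ε, hε0, φ, hφ⟩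
  have e1 : ∀ i, (Y i ω)ᴴ = Y i ω := fun i => congrFun (hY1 i) ω
  have e2 : ∀ i, Y i ω * Y i ω = 1 := fun i => congrFun (hY2 i) ω
  have f1 : ∀ j, (X j ω)ᴴ = X j ω := fun j => congrFun (hX1 j) ω
  have f2 : ∀ j, X j ω * X j ω = 1 := fun j => congrFun (hX2 j) ω
  refine ⟨conjXORStrategy (fun i => Y i ω) (fun j => X j ω) e1 e2 f1 f2, rfl,
    isMaximallyEntangled_maxEntangled, ?_, fun j => ?_, fun i hi => ?_⟩
  · have h4 : ∑ i, c i - (∑ i, K i) * ε ≤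
        G.bias (conjXORStrategy (fun i => Y i ω) (fun j => X j ω) e1 e2 f1 f2) := by
      rw [bias_conjXORStrategy, Finset.sum_mul, ← Finset.sum_sub_distrib]
      exact Finset.sum_le_sum fun i _ => h₃ i ω
    have h5 := G.exists_optimal_strategy.2.1
      (conjXORStrategy (fun i => Y i ω) (fun j => X j ω) e1 e2 f1 f2)
    rw [← hc.sum_eq_optimalBias] at h4
    have h6 : (∑ i, K i) * ε ≤ max (∑ i, K i) (max C₁ C₂) * ε :=
      mul_le_mul_of_nonneg_right (le_max_left _ _) hε0
    rw [IsOptimalUpTo, abs_sub_comm, abs_of_nonneg (by linarith)]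
    linarith
  · exact (h₁ j ω).trans (mul_le_mul_of_nonneg_right
      ((le_max_left _ _).trans (le_max_right _ _)) hε0)
  · have h4 := h₂ ⟨i, hi⟩ ω
    refine (littleFrob_map_star_sub (Y i ω)
      ((c i : ℂ)⁻¹ • ∑ j, (G.cost i j : ℂ) • φ j)).trans_le (le_trans (le_of_eq ?_)
        (h4.trans (mul_le_mul_of_nonneg_right
          ((le_max_right _ _).trans (le_max_right _ _)) hε0)))
    simp [ApproxRep.fam, ω]

end XORGame

end GameAlg

end

open GameAlg in
theorem theorem1p2 :
    -- synchronous games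
    (∀ (I A : Type*) [Fintype I] [Fintype A] [Nonempty A] (G : SynchronousGame I A),
      ∃ C : ℝ, ∀ (d : ℕ) [NeZero d] (ε : ℝ) (φ : I × A → Matrix (Fin d) (Fin d) ℂ), 0 ≤ ε →
        G.algebra.IsApproxRep ε φ →
        ∃ S : QStrategy (fun _ : I => A) (fun _ : I => A) d d,
          S.ψ = maxEntangled d ∧ IsMaximallyEntangled S.ψ ∧ IsSynchronous S ∧
          G.IsPerfectUpTo (C * ε ^ 2) S ∧
          (∀ i a, littleFrob (S.Q i a - φ (i, a)) ≤ C * ε) ∧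
          (∀ i a, littleFrob (S.P i a - (φ (i, a)).map star) ≤ C * ε)) ∧
    -- binary constraint system games
    (∀ (m n : ℕ) (G : BCSGame m n),
      ∃ C : ℝ, ∀ (d : ℕ) [NeZero d] (ε : ℝ) (φ : Fin n → Matrix (Fin d) (Fin d) ℂ), 0 ≤ ε →
        G.algebra.IsApproxRep ε φ →
        ∃ S : QStrategy G.Assign (fun _ : Fin n => Bool) d d,
          S.ψ = maxEntangled d ∧ IsMaximallyEntangled S.ψ ∧
          G.toNonlocalGame.IsPerfectUpTo (C * ε ^ 2) S ∧
          (∀ j, littleFrob (BCSGame.obsB S j - φ j) ≤ C * ε) ∧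
          (∀ i l, littleFrob (BCSGame.obsA S i l - (φ (G.scope i l)).map star) ≤ C * ε)) ∧
    -- XOR games
    (∀ (m n : ℕ) (G : XORGame m n), (∃! c : Fin m → ℝ, G.IsRowBiases c) ∧
      ∀ c : Fin m → ℝ, G.IsRowBiases c →
      ∃ C : ℝ, ∀ (d : ℕ) [NeZero d] (ε : ℝ) (φ : Fin n → Matrix (Fin d) (Fin d) ℂ), 0 ≤ ε →
        (G.algebra c).IsApproxRep ε φ →
        ∃ S : XORStrategy m n d d,
          S.ψ = maxEntangled d ∧ IsMaximallyEntangled S.ψ ∧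
          G.IsOptimalUpTo (C * ε) S ∧
          (∀ j, littleFrob (S.X j - φ j) ≤ C * ε) ∧
          (∀ i, c i ≠ 0 → littleFrob
            (S.Y i - ((c i : ℂ)⁻¹ • ∑ j, (G.cost i j : ℂ) • φ j).map star) ≤ C * ε)) := by
  exact ⟨fun I A _ _ _ G => G.exists_approx_strategy, fun m n G => G.exists_approx_strategy,
    fun m n G => ⟨G.existsUnique_rowBiases, fun c hc => G.exists_approx_strategy hc⟩⟩
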